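/- **Setting.** Let $f:\mathbb{R}^d\to\mathbb{R}$ be twice differentiable and $k$-strongly convex ($\nabla^2 f(\mathbf w)\succeq k\mathbf I$ for all $\mathbf w$, with $k>0$), with $L$-Lipschitz Hessian: $\|\nabla^2 f(\mathbf w+\Delta)-\nabla^2 f(\mathbf w)\|_2\le L\|\Delta\|_2$ for all $\mathbf w,\Delta$ (spectral norm, $L>0$). Let $\mathbf w^*$ be the minimizer of $f$, let $\gamma$ and $\beta$ be the smallest and largest eigenvalues of $\nabla^2 f(\mathbf w^*)$, and for each $\mathbf w$ let $\mathbf A(\mathbf w)\in\mathbb{R}^{n\times d}$ satisfy $\mathbf A(\mathbf w)^T\mathbf A(\mathbf w)=\nabla^2 f(\mathbf w)$. A *Count-Sketch* matrix in $\mathbb{R}^{n\times b}$ has in each row $j$ exactly one nonzero entry, in a column $h(j)$ uniform on $\{1,\dots,b\}$ and equal to a uniform random sign, all these choices being independent. The *OverSketch* matrix is $\frac{1}{\sqrt N}(\mathbf S_1,\dots,\mathbf S_{N+e})\in\mathbb{R}^{n\times(N+e)b}$ with i.i.d. $n\times b$ Count-Sketch blocks. In each iteration $t=0,1,2,\dots$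 an OverSketch matrix is drawn and exactly $N$ of the $N+e$ blocks are returned (the others are lost to stragglers); $\mathbf S_t\in\mathbb{R}^{n\times Nb}$ denotes the OverSketch matrix with only the returned blocks kept. The OverSketch matrix of iteration $t$ is independent of the set of blocks returned in iteration $t$ and of all earlier iterations. *OverSketched Newton* with unit step size is $$\mathbf w_{t+1}=\mathbf w_t-\hat{\mathbf H}_t^{-1}\nabla f(\mathbf w_t),\qquad \hat{\mathbf H}_t=\mathbf A(\mathbf w_t)^T\mathbf S_t\mathbf S_t^T\mathbf A(\mathbf w_t).$$ **Theorem (local convergence for strongly convex $f$).** Let $\mu,\tau,\zeta>0$. There is a constant $\kappa_1>0$ depending only on $\mu,\tau,\zeta$ and, for every $\kappa_2\ge\kappa_1$, a constant $C>0$ depending only on $\mu,\tau,\zeta,\kappa_2$, such that the following holds for all $d,n,f,\mathbf A$ as above, every $\epsilon\in(0,\gamma/(8\beta)]$, all integers $N,e,b\ge 0$ with $e\le\zeta N$ (at most $e$ stragglers per $N+e$ workers) and $$\frac{\kappa_1}{\epsilon}\le N+e\le\frac{\kappa_2}{\epsilon},\qquad Nb+eb\ \ge\ C\,\frac{d^{1+\mu}}{\epsilon^2},$$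 every $T\ge1$, and every (deterministic) $\mathbf w_0$ with $\|\mathbf w_0-\mathbf w^*\|_2\le\frac{\gamma}{8L}$. With probability at least $1-T/d^\tau$, for all $t=0,1,\dots,T$ the matrix $\hat{\mathbf H}_t$ is invertible and $$\|\mathbf w_{t+1}-\mathbf w^*\|_2\le\frac{25L}{8\gamma}\|\mathbf w_t-\mathbf w^*\|_2^2+\frac{5\epsilon\beta}{\gamma}\|\mathbf w_t-\mathbf w^*\|_2 .$$ -/

import Mathlib

open MeasureTheory ProbabilityTheory
open scoped Matrix

/-- The parameter space `ℝ^d` with the Euclidean norm. -/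
abbrev Vec (d : ℕ) : Type := EuclideanSpace ℝ (Fin d)

/-- The Hessian `∇²f(w)`, as the derivative of the gradient; its operator norm is the spectral
norm. -/
noncomputable def hessian {d : ℕ} (f : Vec d → ℝ) (w : Vec d) : Vec d →L[ℝ] Vec d :=
  fderiv ℝ (gradient f) w

/-- `f` is twice differentiable on `ℝ^d`. -/
def TwiceDifferentiable {d : ℕ} (f : Vec d → ℝ) : Prop :=
  Differentiable ℝ f ∧ Differentiable ℝ (gradient f)

/-- `∇²f(w) ⪰ k I` for every `w`. -/
def HessianStronglyConvex {d : ℕ} (k : ℝ) (f : Vec d → ℝ) : Prop :=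
  ∀ w v : Vec d, k * ‖v‖ ^ 2 ≤ inner ℝ v (hessian f w v)

/-- The Hessian of `f` is `L`-Lipschitz in spectral norm. -/
def HessianLipschitz {d : ℕ} (L : ℝ) (f : Vec d → ℝ) : Prop :=
  ∀ w Δ : Vec d, ‖hessian f (w + Δ) - hessian f w‖ ≤ L * ‖Δ‖

/-- `a` is an eigenvalue of `∇²f(w)`. -/
def IsHessianEigenvalue {d : ℕ} (f : Vec d → ℝ) (w : Vec d) (a : ℝ) : Prop :=
  Module.End.HasEigenvalue (hessian f w : Vec d →ₗ[ℝ] Vec d) a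

/-- `A w` is an `n × d` square root of `∇²f(w)`, i.e. `(A w)ᵀ (A w) = ∇²f(w)`, for every `w`. -/
def IsHessianSqrt {n d : ℕ} (f : Vec d → ℝ) (A : Vec d → Matrix (Fin n) (Fin d) ℝ) : Prop :=
  ∀ w : Vec d, Matrix.toEuclideanCLM (𝕜 := ℝ) ((A w)ᵀ * A w) = hessian f w

/-- The random choices behind one `n × b` Count-Sketch matrix: for every row `j` the column `h(j)`
of the nonzero entry and its sign (`true` is `+1`, `false` is `-1`). -/
abbrev CountSeed (n b : ℕ) : Type := Fin n → Fin b × Bool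

/-- The random choices behind `K` Count-Sketch matrices. -/
abbrev SketchSeed (n b K : ℕ) : Type := Fin K → CountSeed n b

/-- The Count-Sketch matrix: row `j` has the single nonzero entry `±1`, in column `h(j)`. -/
def countSketch {n b : ℕ} (s : CountSeed n b) : Matrix (Fin n) (Fin b) ℝ :=
  Matrix.of fun j l => if (s j).1 = l then (if (s j).2 then 1 else -1) else 0

/-- The OverSketch matrix `(1/√N) (S_1, …, S_{N+e})`, of size `n × (N+e)b`; column `(i, l)` is the
`l`-th column of the block `S_i`. -/
noncomputable def overSketch {n b N e : ℕ} (s : SketchSeed n b (N + e)) :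
    Matrix (Fin n) (Fin (N + e) × Fin b) ℝ :=
  Matrix.of fun j p => 1 / Real.sqrt (N : ℝ) * countSketch (s p.1) j p.2

/-- The OverSketch matrix after ignoring the stragglers: only the column blocks of the `N` workers
`r 0, …, r (N-1)` that have returned are kept. -/
noncomputable def survivingSketch {n b N e : ℕ} (s : SketchSeed n b (N + e))
    (r : Fin N → Fin (N + e)) : Matrix (Fin n) (Fin N × Fin b) ℝ :=
  (overSketch s).submatrix id (Prod.map r id)

/-- The sketched Hessian `Ĥ = Aᵀ S Sᵀ A`. -/
def sketchedHessian {n d : ℕ} {κ : Type} [Fintype κ] (A : Matrix (Fin n) (Fin d) ℝ)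
    (S : Matrix (Fin n) κ ℝ) : Matrix (Fin d) (Fin d) ℝ :=
  Aᵀ * S * Sᵀ * A

/-- The iterates of OverSketched Newton with unit step size, started at `w₀` and using the sketch
`S t` in iteration `t`: `w_{t+1} = w_t - Ĥ_t⁻¹ ∇f(w_t)` with `Ĥ_t = A(w_t)ᵀ S_t S_tᵀ A(w_t)`. -/
noncomputable def osnIterate {n d : ℕ} {κ : Type} [Fintype κ] (f : Vec d → ℝ)
    (A : Vec d → Matrix (Fin n) (Fin d) ℝ) (w₀ : Vec d) (S : ℕ → Matrix (Fin n) κ ℝ) : ℕ → Vec d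
  | 0 => w₀
  | t + 1 =>
    osnIterate f A w₀ S t -
      Matrix.toEuclideanCLM (𝕜 := ℝ) (sketchedHessian (A (osnIterate f A w₀ S t)) (S t))⁻¹
        (gradient f (osnIterate f A w₀ S t))

/-- The random model. In iteration `t` the seed of the `N + e` Count-Sketch blocks is uniform (so
all `h(j)` and all signs in all blocks are independent and uniform), `ret t ω` lists `N` different
workers that return their results, and the seed is independent of which workers straggle in
iteration `t` and of everything that happened in the earlier iterations. -/
structure IsOverSketchProcess {Ω : Type*} [MeasurableSpace Ω] (P : Measure Ω) {n b N e : ℕ}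
    (seed : ℕ → Ω → SketchSeed n b (N + e)) (ret : ℕ → Ω → Fin N → Fin (N + e)) : Prop where
  measurable_seed : ∀ t, Measurable (seed t)
  measurable_ret : ∀ t, Measurable (ret t)
  law_seed : ∀ t, P.map (seed t) = uniformOn (Set.univ : Set (SketchSeed n b (N + e)))
  injective_ret : ∀ t ω, Function.Injective (ret t ω)
  indep : ∀ t : ℕ, IndepFun (seed t)
    (fun ω => (ret t ω, fun s : Fin t => (seed s ω, ret s ω))) P

/-!
Everything rests on the fact that the surviving part of an OverSketch matrix is a subspace embedding:
with probability at least `1 - d ^ (-τ) / 2`, the quadratic forms of the sketched Hessian `Ĥ` and of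
the Hessian `H` differ by at most the factor `1 ± ε`. The current iterate and the set of survivors
are independent of the current seed (`measure_not_isAccurate_le`), so this can be proved for a fixed
matrix and fixed survivors, and the failures in the `T + 1 ≤ 2 T` iterations add up to at most
`T / d ^ τ`. On the good event a Newton step is deterministic (`newton_step`): the error `δ` becomes
`Ĥ⁻¹ ((Ĥ - H) δ + (H δ - ∇f))`, where the first term is of order `ε β ‖δ‖`, the second one of order
`L ‖δ‖²`, and `Ĥ` is at least a constant times `γ` as long as the iterates stay in the initial ball,
which they do.

For the embedding, write `H = AᵀA` and change variables so that the columns of `U = A B` are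
orthonormal. The distortion `Uᵀ S Sᵀ U - 1` is `1 / N` times the sum, over all buckets of all
surviving blocks, of `W = v vᵀ - D`, where `v` is the signed sum of the rows of `U` in the bucket and
`D` is the sum of their squares `u uᵀ` (`dotProduct_sketchedHessian_sub`). The matrix Laplace
transform method, in the form given by the Golden–Thompson inequality (`trace_exp_add_le`), bounds
the distortion by the exponential moments of the single buckets. These are small: `W` has mean zero
and second moment of order `d / b²`, it is bounded below by `-1`, and it is bounded above by `‖v‖²`,
which by a Pinelis type estimate (`prodExp_norm_gt_le`) exceeds a large constant only with
probability `(2 d / b)` to a large power. Thus the parameter `λ` of the Laplace transform can be a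
small multiple of `log d`: the factor `e ^ (λ ‖v‖²)` is then at most `d ^ (μ / 2)` and is absorbed by
the surplus `d ^ μ` in the sketch dimension, while `κ / ε` blocks are enough for `e ^ (-λ ε N / 2)` to
beat the dimension and the failure probability (`failure_bound`).

The buckets of one block are not independent, since each row falls into exactly one of them. They are
revealed one at a time (`prodExp_trace_exp_buckets_le`): given the earlier buckets, the remaining rows
fall independently into the next one, and with at most half of the buckets revealed the conditional
probability of this is at most `2 / b`. The two halves are treated separately.
-/

/-! ### The Golden–Thompson inequality -/

section GoldenThompson

variable {m : Type*} [Fintype m] [DecidableEq m]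

theorem trace_mul_pow_comm (A B : Matrix m m ℝ) (k : ℕ) :
    ((A * B) ^ k).trace = ((B * A) ^ k).trace := by
  rcases k with _ | k
  · simp
  · have h : ∀ j : ℕ, A * (B * A) ^ j = (A * B) ^ j * A := by
      intro j
      induction j with
      | zero => simp
      | succ j ih =>
        rw [pow_succ, ← mul_assoc, ih, pow_succ]
        simp only [mul_assoc]
    rw [pow_succ, ← mul_assoc, ← h, Matrix.trace_mul_comm, ← mul_assoc, ← pow_succ']

theorem two_trace_mul_transpose_le {m : Type*} [Fintype m] (P Q : Matrix m m ℝ) :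
    2 * (P * Qᵀ).trace ≤ (P * Pᵀ).trace + (Q * Qᵀ).trace := by
  have h : 0 ≤ ((P - Q) * (P - Q)ᵀ).trace := by
    simp only [Matrix.trace, Matrix.diag, Matrix.mul_apply, Matrix.transpose_apply]
    exact Finset.sum_nonneg fun i _ => Finset.sum_nonneg fun j _ => mul_self_nonneg _
  have h2 : (Q * Pᵀ).trace = (P * Qᵀ).trace := by
    rw [← Matrix.trace_transpose, Matrix.transpose_mul, Matrix.transpose_transpose]
  simp only [Matrix.transpose_sub, sub_mul, mul_sub, Matrix.trace_sub] at h
  linarith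

/-- Two trace inequalities for exponents that are powers of two, by a joint induction: passing from
`M²` to `(M²)(M²)ᵀ` produces, up to a cyclic permutation, a power of the product of the symmetric
matrices `MᵀM` and `MMᵀ`, to which the second inequality applies. -/
theorem trace_pow_two_pow_aux (j : ℕ) :
    (∀ M : Matrix m m ℝ, (M ^ 2 ^ (j + 1)).trace ≤ ((M * Mᵀ) ^ 2 ^ j).trace) ∧
    (∀ P Q : Matrix m m ℝ, P.IsSymm → Q.IsSymm →
      ((P * Q) ^ 2 ^ j).trace ≤ (P ^ 2 ^ j * Q ^ 2 ^ j).trace) := by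
  induction j with
  | zero =>
    refine ⟨fun M => ?_, fun P Q _ _ => by simp⟩
    have := two_trace_mul_transpose_le M Mᵀ
    have h2 : (Mᵀ * Mᵀᵀ).trace = (M * Mᵀ).trace := by
      rw [Matrix.transpose_transpose, Matrix.trace_mul_comm]
    rw [Matrix.transpose_transpose] at this h2
    simp only [zero_add, pow_one, pow_zero, pow_two]
    linarith
  | succ j ih =>
    obtain ⟨ihS, ihT⟩ := ih
    constructor
    · intro M
      have h1 : (M ^ 2 ^ (j + 1 + 1)).trace ≤ (((M * M) * (M * M)ᵀ) ^ 2 ^ j).trace := by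
        have := ihS (M * M)
        rwa [← pow_two, ← pow_mul, ← pow_succ', pow_two] at this
      have h2 : (((M * M) * (M * M)ᵀ) ^ 2 ^ j).trace
          = (((Mᵀ * M) * (M * Mᵀ)) ^ 2 ^ j).trace := by
        rw [Matrix.transpose_mul,
          show M * M * (Mᵀ * Mᵀ) = (M * M * Mᵀ) * Mᵀ by simp only [mul_assoc],
          trace_mul_pow_comm]
        simp only [mul_assoc]
      have s1 : (Mᵀ * M).IsSymm := by simp [Matrix.IsSymm]
      have s2 : (M * Mᵀ).IsSymm := by simp [Matrix.IsSymm]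
      have h3 := ihT _ _ s1 s2
      have h4 := two_trace_mul_transpose_le ((Mᵀ * M) ^ 2 ^ j) ((M * Mᵀ) ^ 2 ^ j)
      rw [(s1.pow _).eq, (s2.pow _).eq, ← pow_add, ← pow_add, ← two_mul, ← pow_succ',
        trace_mul_pow_comm Mᵀ M] at h4
      linarith
    · intro P Q hP hQ
      have h1 := ihS (P * Q)
      have h2 : (((P * Q) * (P * Q)ᵀ) ^ 2 ^ j).trace = (((P * P) * (Q * Q)) ^ 2 ^ j).trace := by
        rw [Matrix.transpose_mul, hP.eq, hQ.eq,
          show P * Q * (Q * P) = (P * Q * Q) * P by simp only [mul_assoc],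
          trace_mul_pow_comm]
        simp only [mul_assoc]
      have s1 : (P * P).IsSymm := by simp [Matrix.IsSymm, hP.eq]
      have s2 : (Q * Q).IsSymm := by simp [Matrix.IsSymm, hQ.eq]
      have h3 := ihT _ _ s1 s2
      rw [← pow_two, ← pow_two, ← pow_mul, ← pow_mul, ← pow_succ'] at h3
      rw [← pow_two, ← pow_two] at h2
      linarith

theorem trace_mul_pow_two_pow_le {P Q : Matrix m m ℝ} (hP : P.IsSymm) (hQ : Q.IsSymm) (j : ℕ) :
    ((P * Q) ^ 2 ^ j).trace ≤ (P ^ 2 ^ j * Q ^ 2 ^ j).trace :=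
  (trace_pow_two_pow_aux j).2 P Q hP hQ

end GoldenThompson

section LieProduct

open Filter Topology NormedSpace

variable {𝔸 : Type*} [NormedRing 𝔸] [NormedAlgebra ℝ 𝔸] [CompleteSpace 𝔸] [NormOneClass 𝔸]

theorem norm_pow_sub_pow_le {𝔸 : Type*} [NormedRing 𝔸] [NormOneClass 𝔸] {x y : 𝔸} {M : ℝ} (hM : 1 ≤ M) (hx : ‖x‖ ≤ M) (hy : ‖y‖ ≤ M) (n : ℕ) :
    ‖x ^ n - y ^ n‖ ≤ n * M ^ n * ‖x - y‖ := by
  induction n with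
  | zero => simp
  | succ n ih =>
    have e : x ^ (n + 1) - y ^ (n + 1) = x ^ n * (x - y) + (x ^ n - y ^ n) * y := by
      rw [pow_succ, pow_succ]; noncomm_ring
    have hxn : ‖x ^ n‖ ≤ M ^ n := (norm_pow_le x n).trans (pow_le_pow_left₀ (norm_nonneg _) hx n)
    have h1 : ‖x ^ n * (x - y)‖ ≤ M ^ (n + 1) * ‖x - y‖ := by
      refine (norm_mul_le _ _).trans (mul_le_mul_of_nonneg_right ?_ (norm_nonneg _))
      exact hxn.trans (pow_le_pow_right₀ hM n.le_succ)
    have h2 : ‖(x ^ n - y ^ n) * y‖ ≤ n * M ^ (n + 1) * ‖x - y‖ := by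
      refine (norm_mul_le _ _).trans ?_
      calc _ ≤ (n * M ^ n * ‖x - y‖) * M := by gcongr
        _ = _ := by ring
    rw [e]
    refine (norm_add_le _ _).trans ?_
    push_cast
    linarith

theorem norm_exp_le_exp_norm (x : 𝔸) : ‖exp x‖ ≤ Real.exp ‖x‖ := by
  rw [congrFun (exp_eq_tsum ℝ) x, Real.exp_eq_exp_ℝ, congrFun (exp_eq_tsum_div (𝔸 := ℝ)) ‖x‖]
  have hs : Summable fun n : ℕ => ‖x‖ ^ n / (n.factorial : ℝ) := Real.summable_pow_div_factorial ‖x‖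
  refine tsum_of_norm_bounded hs.hasSum fun n => ?_
  rw [norm_smul, norm_inv, Real.norm_natCast, inv_mul_eq_div]
  gcongr
  exact norm_pow_le x n

/-- The **Lie product formula**. -/
theorem tendsto_exp_mul_exp_pow (A B : 𝔸) :
    Tendsto (fun n : ℕ => (exp ((n : ℝ)⁻¹ • A) * exp ((n : ℝ)⁻¹ • B)) ^ n) atTop
      (𝓝 (exp (A + B))) := by
  have hφ : HasDerivAt (fun h : ℝ => exp (h • A) * exp (h • B) - exp (h • (A + B))) 0 0 := by
    have hA := hasDerivAt_exp_smul_const (𝕂 := ℝ) A (0 : ℝ)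
    have hB := hasDerivAt_exp_smul_const (𝕂 := ℝ) B (0 : ℝ)
    have hAB := hasDerivAt_exp_smul_const (𝕂 := ℝ) (A + B) (0 : ℝ)
    have := (hA.mul hB).sub hAB
    simp only [zero_smul, exp_zero, one_mul, mul_one, sub_self] at this
    exact this
  -- both sides have the same derivative at `0`, so they differ by `o(1/n)` at `h = 1/n`
  have ho := hφ.isLittleO
  have hn : Tendsto (fun n : ℕ => (n : ℝ)⁻¹) atTop (𝓝 0) := tendsto_inv_atTop_nhds_zero_nat
  have ho2 := ho.comp_tendsto hn
  rw [tendsto_iff_norm_sub_tendsto_zero]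
  set M : ℝ := Real.exp (‖A‖ + ‖B‖) with hMdef
  have hbound : ∀ᶠ n : ℕ in atTop,
      ‖(exp ((n : ℝ)⁻¹ • A) * exp ((n : ℝ)⁻¹ • B)) ^ n - exp (A + B)‖ ≤
        M * (n * ‖exp ((n : ℝ)⁻¹ • A) * exp ((n : ℝ)⁻¹ • B) - exp ((n : ℝ)⁻¹ • (A + B))‖) := by
    filter_upwards [eventually_gt_atTop 0] with n hn0
    have hn0' : (0 : ℝ) < n := by exact_mod_cast hn0
    have e1 : exp (A + B) = exp ((n : ℝ)⁻¹ • (A + B)) ^ n := by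
      let _ : NormedAlgebra ℚ 𝔸 := NormedAlgebra.restrictScalars ℚ ℝ 𝔸
      rw [← exp_nsmul, ← Nat.cast_smul_eq_nsmul ℝ, smul_smul, mul_inv_cancel₀ hn0'.ne', one_smul]
    have nA : ‖(n : ℝ)⁻¹ • A‖ = ‖A‖ / n := by
      rw [norm_smul, norm_inv, Real.norm_natCast]; ring
    have nB : ‖(n : ℝ)⁻¹ • B‖ = ‖B‖ / n := by
      rw [norm_smul, norm_inv, Real.norm_natCast]; ring
    have nAB : ‖(n : ℝ)⁻¹ • (A + B)‖ ≤ (‖A‖ + ‖B‖) / n := by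
      rw [norm_smul, norm_inv, Real.norm_natCast, inv_mul_eq_div]
      gcongr
      exact norm_add_le _ _
    have b1 : ‖exp ((n : ℝ)⁻¹ • A) * exp ((n : ℝ)⁻¹ • B)‖ ≤ Real.exp ((‖A‖ + ‖B‖) / n) := by
      refine (norm_mul_le _ _).trans ?_
      rw [add_div, Real.exp_add]
      refine mul_le_mul ?_ ?_ (norm_nonneg _) (Real.exp_pos _).le
      · rw [← nA]; exact norm_exp_le_exp_norm _
      · rw [← nB]; exact norm_exp_le_exp_norm _
    have b2 : ‖exp ((n : ℝ)⁻¹ • (A + B))‖ ≤ Real.exp ((‖A‖ + ‖B‖) / n) :=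
      (norm_exp_le_exp_norm _).trans (Real.exp_le_exp.2 nAB)
    have := norm_pow_sub_pow_le (Real.one_le_exp (by positivity)) b1 b2 n
    rw [← Real.exp_nat_mul, mul_div_cancel₀ _ hn0'.ne'] at this
    rw [e1]
    refine this.trans (le_of_eq ?_)
    ring
  have hlim : Tendsto (fun n : ℕ => M * (n * ‖exp ((n : ℝ)⁻¹ • A) * exp ((n : ℝ)⁻¹ • B) -
      exp ((n : ℝ)⁻¹ • (A + B))‖)) atTop (𝓝 0) := by
    have h3 := ho2.norm_left.tendsto_div_nhds_zero
    have h4 := h3.const_mul M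
    rw [mul_zero] at h4
    refine h4.congr fun n => ?_
    simp only [Function.comp_apply, zero_smul, exp_zero, one_mul, sub_self, sub_zero, smul_zero,
      div_inv_eq_mul]
    rw [mul_comm ‖_‖]
  exact squeeze_zero' (Eventually.of_forall fun _ => norm_nonneg _) hbound hlim

end LieProduct

section

open Filter Topology NormedSpace

attribute [local instance] Matrix.linftyOpNormedRing Matrix.linftyOpNormedAlgebra
  Matrix.linfty_opNormOneClass

/-- **Golden–Thompson inequality** for real symmetric matrices. -/
theorem trace_exp_add_le {m : Type*} [Fintype m] [DecidableEq m] {A B : Matrix m m ℝ}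
    (hA : A.IsSymm) (hB : B.IsSymm) :
    (exp (A + B)).trace ≤ (exp A * exp B).trace := by
  rcases isEmpty_or_nonempty m with h | h
  · simp [Matrix.trace]
  have h1 := tendsto_exp_mul_exp_pow A B
  have h2 := h1.comp (tendsto_pow_atTop_atTop_of_one_lt (r := 2) one_lt_two)
  have hcont : Continuous (fun M : Matrix m m ℝ => M.trace) := continuous_id.matrix_trace
  have h3 := (hcont.tendsto _).comp h2
  refine le_of_tendsto' h3 fun j => ?_
  have hn : ((2 ^ j : ℕ) : ℝ) ≠ 0 := by positivity
  have e : ∀ X : Matrix m m ℝ, exp (((2 ^ j : ℕ) : ℝ)⁻¹ • X) ^ 2 ^ j = exp X := by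
    intro X
    rw [← Matrix.exp_nsmul, ← Nat.cast_smul_eq_nsmul ℝ, smul_smul, mul_inv_cancel₀ hn, one_smul]
  have sy : ∀ X : Matrix m m ℝ, X.IsSymm → (exp (((2 ^ j : ℕ) : ℝ)⁻¹ • X)).IsSymm :=
    fun X hX => Matrix.IsSymm.exp (hX.smul _)
  have := trace_mul_pow_two_pow_le (sy A hA) (sy B hB) j
  rw [e, e] at this
  exact this

end

/-! ### Exponentials of symmetric matrices -/

section SymmetricExp

open NormedSpace

variable {m : Type*} [Fintype m] [DecidableEq m]

/-- Orthogonal diagonalization of a real symmetric matrix together with its exponential, in terms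
of quadratic forms. -/
theorem exists_orthogonal_diagonalization {Z : Matrix m m ℝ} (hZ : Z.IsSymm) :
    ∃ (O : Matrix m m ℝ) (v : m → ℝ), O * Oᵀ = 1 ∧ Oᵀ * O = 1 ∧
      Z = O * Matrix.diagonal v * Oᵀ ∧
      exp Z = O * Matrix.diagonal (fun i => Real.exp (v i)) * Oᵀ := by
  have hH : Z.IsHermitian := Matrix.isHermitian_iff_isSymm.2 hZ
  set O : Matrix m m ℝ := (hH.eigenvectorUnitary : Matrix m m ℝ) with hO
  have h1 : O * Oᵀ = 1 := by
    have := Unitary.coe_mul_star_self hH.eigenvectorUnitary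
    rwa [Unitary.coe_star, Matrix.star_eq_conjTranspose,
      Matrix.conjTranspose_eq_transpose_of_trivial] at this
  have h2 : Oᵀ * O = 1 := mul_eq_one_comm.1 h1
  have h3 : Z = O * Matrix.diagonal hH.eigenvalues * Oᵀ := by
    have := hH.spectral_theorem
    rw [Unitary.conjStarAlgAut_apply, Matrix.star_eq_conjTranspose,
      Matrix.conjTranspose_eq_transpose_of_trivial] at this
    exact this
  refine ⟨O, hH.eigenvalues, h1, h2, h3, ?_⟩
  have hinv : O⁻¹ = Oᵀ := Matrix.inv_eq_right_inv h1
  have hu : IsUnit O := IsUnit.of_mul_eq_one _ h1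
  conv_lhs => rw [h3, ← hinv, Matrix.exp_conj _ _ hu, Matrix.exp_diagonal, hinv]
  congr 3
  ext i
  rw [Pi.coe_exp, Real.exp_eq_exp_ℝ]

theorem dotProduct_diagonalization (O : Matrix m m ℝ) (v x : m → ℝ) :
    x ⬝ᵥ (O * Matrix.diagonal v * Oᵀ) *ᵥ x = ∑ i, v i * (Oᵀ *ᵥ x) i ^ 2 := by
  rw [← Matrix.mulVec_mulVec, ← Matrix.mulVec_mulVec, Matrix.dotProduct_mulVec,
    ← Matrix.mulVec_transpose, dotProduct]
  refine Finset.sum_congr rfl fun i _ => ?_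
  rw [Matrix.mulVec_diagonal]
  ring

theorem exp_le_one_add_add_mul_sq {x M : ℝ} (hM : 0 ≤ M) (hx : x ≤ M) :
    Real.exp x ≤ 1 + x + Real.exp M * x ^ 2 := by
  have hexp : ∀ y : ℝ, 1 - y ≤ Real.exp (-y) := fun y => by
    linarith [Real.add_one_le_exp (-y)]
  have hmul : Real.exp x * Real.exp (-x) = 1 := by rw [← Real.exp_add]; simp
  have hpos := Real.exp_pos x
  have hx1 := mul_le_mul_of_nonneg_left (hexp x) hpos.le
  rcases le_total 0 x with h0 | h0
  · have h2 : Real.exp x ≤ Real.exp M := Real.exp_le_exp.2 hx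
    nlinarith [mul_le_mul_of_nonneg_left hx1 h0, mul_le_mul_of_nonneg_left h2 (sq_nonneg x)]
  · have h2 : 1 ≤ Real.exp M := Real.one_le_exp hM
    have h3 : Real.exp x ≤ 1 + x + x ^ 2 := by
      have h4 : 0 < 1 - x := by linarith
      refine le_of_mul_le_mul_right ?_ h4
      nlinarith [mul_nonneg_of_nonpos_of_nonpos h0 h0, mul_nonneg (sq_nonneg x) (neg_nonneg.2 h0)]
    nlinarith [mul_le_mul_of_nonneg_right h2 (sq_nonneg x)]

/-- A symmetric matrix `Z ≤ M` satisfies `exp Z ≤ 1 + Z + e^M Z²`. -/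
theorem dotProduct_exp_le {Z : Matrix m m ℝ} (hZ : Z.IsSymm) {M : ℝ} (hM : 0 ≤ M)
    (h : ∀ x, x ⬝ᵥ Z *ᵥ x ≤ M * (x ⬝ᵥ x)) (x : m → ℝ) :
    x ⬝ᵥ exp Z *ᵥ x ≤ x ⬝ᵥ x + x ⬝ᵥ Z *ᵥ x + Real.exp M * ((Z *ᵥ x) ⬝ᵥ (Z *ᵥ x)) := by
  obtain ⟨O, v, h1, h2, h3, h4⟩ := exists_orthogonal_diagonalization hZ
  have hv : ∀ i, v i ≤ M := by
    intro i
    have hi := h (O *ᵥ Pi.single i 1)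
    have e1 : Oᵀ *ᵥ (O *ᵥ Pi.single i (1 : ℝ)) = Pi.single i 1 := by
      rw [Matrix.mulVec_mulVec, h2, Matrix.one_mulVec]
    rw [h3, dotProduct_diagonalization, e1, Matrix.dotProduct_mulVec, ← Matrix.mulVec_transpose,
      e1] at hi
    simpa [Pi.single_apply] using hi
  have hsq : (Z *ᵥ x) ⬝ᵥ (Z *ᵥ x) = ∑ i, v i ^ 2 * (Oᵀ *ᵥ x) i ^ 2 := by
    rw [Matrix.dotProduct_mulVec, ← Matrix.mulVec_transpose, hZ.eq, dotProduct_comm,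
      Matrix.mulVec_mulVec]
    have : Z * Z = O * Matrix.diagonal (fun i => v i ^ 2) * Oᵀ := by
      rw [h3]
      calc O * Matrix.diagonal v * Oᵀ * (O * Matrix.diagonal v * Oᵀ)
          = O * Matrix.diagonal v * (Oᵀ * O) * Matrix.diagonal v * Oᵀ := by
            simp only [mul_assoc]
        _ = _ := by
            rw [h2, mul_one, mul_assoc O, Matrix.diagonal_mul_diagonal]
            simp only [pow_two]
    rw [this, dotProduct_diagonalization]
  have hone : x ⬝ᵥ x = ∑ i, 1 * (Oᵀ *ᵥ x) i ^ 2 := by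
    rw [← dotProduct_diagonalization O (fun _ => 1) x, Matrix.diagonal_one, mul_one, h1,
      Matrix.one_mulVec]
  rw [hsq, hone, h4, dotProduct_diagonalization]
  conv_rhs => rw [h3, dotProduct_diagonalization]
  rw [Finset.mul_sum, ← Finset.sum_add_distrib, ← Finset.sum_add_distrib]
  refine Finset.sum_le_sum fun i _ => ?_
  nlinarith [mul_le_mul_of_nonneg_right (exp_le_one_add_add_mul_sq hM (hv i))
    (sq_nonneg ((Oᵀ *ᵥ x) i))]

/-- If the quadratic form of `Z` exceeds `t` somewhere, then `Z` has an eigenvalue above `t`, which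
is visible in the trace of `exp Z`. -/
theorem exp_le_trace_exp {Z : Matrix m m ℝ} (hZ : Z.IsSymm) {t : ℝ} {x : m → ℝ}
    (h : t * (x ⬝ᵥ x) < x ⬝ᵥ Z *ᵥ x) : Real.exp t ≤ (exp Z).trace := by
  obtain ⟨O, v, h1, h2, h3, h4⟩ := exists_orthogonal_diagonalization hZ
  have hone : x ⬝ᵥ x = ∑ i, 1 * (Oᵀ *ᵥ x) i ^ 2 := by
    rw [← dotProduct_diagonalization O (fun _ => 1) x, Matrix.diagonal_one, mul_one, h1,
      Matrix.one_mulVec]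
  have htr : (exp Z).trace = ∑ i, Real.exp (v i) := by
    rw [h4, Matrix.trace_mul_comm, ← mul_assoc, h2, one_mul, Matrix.trace_diagonal]
  have : ∃ i, t < v i := by
    by_contra! hc
    rw [h3, dotProduct_diagonalization, hone, Finset.mul_sum] at h
    refine absurd h (not_lt.2 (Finset.sum_le_sum fun i _ => ?_))
    rw [one_mul]
    exact mul_le_mul_of_nonneg_right (hc i) (sq_nonneg _)
  obtain ⟨i, hi⟩ := this
  rw [htr]
  exact (Real.exp_le_exp.2 hi.le).trans
    (Finset.single_le_sum (f := fun i => Real.exp (v i)) (fun j _ => (Real.exp_pos _).le)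
      (Finset.mem_univ i))

/-- `tr (e^Y Q)` is a sum of values of the quadratic form of `Q`. -/
theorem exists_trace_exp_mul_eq {Y : Matrix m m ℝ} (hY : Y.IsSymm) :
    ∃ z : m → m → ℝ, ∀ Q : Matrix m m ℝ, (exp Y * Q).trace = ∑ i, z i ⬝ᵥ Q *ᵥ z i := by
  set E : Matrix m m ℝ := exp ((2 : ℝ)⁻¹ • Y) with hE
  have hsym : E.IsSymm := Matrix.IsSymm.exp (hY.smul _)
  have hEE : exp Y = E * E := by
    rw [← pow_two, hE, ← Matrix.exp_nsmul, ← Nat.cast_smul_eq_nsmul ℝ, smul_smul]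
    norm_num
  refine ⟨fun i => E i, fun Q => ?_⟩
  rw [hEE, mul_assoc, Matrix.trace_mul_comm, Matrix.trace]
  refine Finset.sum_congr rfl fun i _ => ?_
  rw [Matrix.dotProduct_mulVec]
  change ∑ k, (E * Q) i k * E k i = ∑ k, (E i ᵥ* Q) k * E i k
  exact Finset.sum_congr rfl fun k _ => by rw [hsym.apply i k]; rfl

end SymmetricExp

/-! ### Expectations over finite product distributions -/

section ProdExp

variable {α κ : Type*} [Fintype α] [Fintype κ]

/-- The expectation of `F (x₁, …, xₙ)` when the `xⱼ` are independent and `xⱼ = a` has probability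
`w a`. -/
def prodExp (w : α → ℝ) {n : ℕ} (F : (Fin n → α) → ℝ) : ℝ :=
  ∑ x, (∏ j, w (x j)) * F x

theorem prodExp_zero (w : α → ℝ) (F : (Fin 0 → α) → ℝ) : prodExp w F = F Fin.elim0 := by
  simp [prodExp, Subsingleton.elim default (Fin.elim0 : Fin 0 → α)]

theorem prodExp_succ (w : α → ℝ) {n : ℕ} (F : (Fin (n + 1) → α) → ℝ) :
    prodExp w F = ∑ a, w a * prodExp w fun x : Fin n → α => F (Fin.cons a x) := by
  unfold prodExp
  rw [← (Fin.consEquiv fun _ : Fin (n + 1) => α).sum_comp, Fintype.sum_prod_type]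
  refine Finset.sum_congr rfl fun a _ => ?_
  rw [Finset.mul_sum]
  refine Finset.sum_congr rfl fun x _ => ?_
  simp [Fin.consEquiv, Fin.prod_univ_succ, mul_assoc]

theorem prodExp_mono {w : α → ℝ} (hw : ∀ a, 0 ≤ w a) {n : ℕ} {F G : (Fin n → α) → ℝ}
    (h : ∀ x, F x ≤ G x) : prodExp w F ≤ prodExp w G :=
  Finset.sum_le_sum fun x _ =>
    mul_le_mul_of_nonneg_left (h x) (Finset.prod_nonneg fun _ _ => hw _)

theorem prodExp_add (w : α → ℝ) {n : ℕ} (F G : (Fin n → α) → ℝ) :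
    prodExp w (fun x => F x + G x) = prodExp w F + prodExp w G := by
  simp [prodExp, mul_add, Finset.sum_add_distrib]

theorem prodExp_const_mul (w : α → ℝ) {n : ℕ} (c : ℝ) (F : (Fin n → α) → ℝ) :
    prodExp w (fun x => c * F x) = c * prodExp w F := by
  simp only [prodExp, Finset.mul_sum]
  exact Finset.sum_congr rfl fun x _ => by ring

theorem prodExp_sum {ι : Type*} (s : Finset ι) (w : α → ℝ) {n : ℕ}
    (F : ι → (Fin n → α) → ℝ) :
    prodExp w (fun x => ∑ i ∈ s, F i x) = ∑ i ∈ s, prodExp w (F i) := by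
  simp only [prodExp, Finset.mul_sum]
  exact Finset.sum_comm

theorem prodExp_const {w : α → ℝ} (hw : ∑ a, w a = 1) {n : ℕ} (c : ℝ) :
    prodExp w (fun _ : Fin n → α => c) = c := by
  induction n with
  | zero => rw [prodExp_zero]
  | succ n ih => rw [prodExp_succ, ih, ← Finset.sum_mul, hw, one_mul]

theorem prodExp_sub (w : α → ℝ) {n : ℕ} (F G : (Fin n → α) → ℝ) :
    prodExp w (fun x => F x - G x) = prodExp w F - prodExp w G := by
  simp [prodExp, mul_sub, Finset.sum_sub_distrib]

/-- Change of variables: `hf` says that `f` maps the distribution `w` to `w'`. -/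
theorem prodExp_comp (w : α → ℝ) (w' : κ → ℝ) (f : α → κ)
    (hf : ∀ G : κ → ℝ, ∑ a, w a * G (f a) = ∑ y, w' y * G y) {n : ℕ}
    (F : (Fin n → κ) → ℝ) :
    prodExp w (fun x => F (fun j => f (x j))) = prodExp w' F := by
  induction n with
  | zero =>
    rw [prodExp_zero, prodExp_zero]
    exact congrArg F (Subsingleton.elim _ _)
  | succ n ih =>
    rw [prodExp_succ, prodExp_succ, ← hf]
    refine Finset.sum_congr rfl fun a _ => ?_
    rw [← ih]
    refine congrArg (fun t => w a * prodExp w t) (funext fun x => congrArg F (funext fun j => ?_))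
    refine Fin.cases ?_ (fun i => ?_) j <;> simp

theorem prodExp_prod (w : α → ℝ) (w' : κ → ℝ) {n : ℕ} (F : (Fin n → α × κ) → ℝ) :
    prodExp (fun p : α × κ => w p.1 * w' p.2) F =
      prodExp w fun x => prodExp w' fun y => F fun j => (x j, y j) := by
  unfold prodExp
  rw [← (Equiv.arrowProdEquivProdArrow (Fin n) (fun _ => α) (fun _ => κ)).symm.sum_comp,
    Fintype.sum_prod_type]
  refine Finset.sum_congr rfl fun x _ => ?_
  rw [Finset.mul_sum]
  refine Finset.sum_congr rfl fun y _ => ?_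
  simp only [Equiv.arrowProdEquivProdArrow, Equiv.coe_fn_symm_mk, Finset.prod_mul_distrib]
  ring

/-- The marginal distribution of one coordinate. -/
theorem prodExp_coord {w : α → ℝ} (hw : ∑ a, w a = 1) {n : ℕ} (i : Fin n) (g : α → ℝ) :
    prodExp w (fun x => g (x i)) = ∑ a, w a * g a := by
  induction n with
  | zero => exact i.elim0
  | succ n ih =>
    rw [prodExp_succ]
    refine Fin.cases ?_ (fun k => ?_) i
    · simp only [Fin.cons_zero]
      exact Finset.sum_congr rfl fun a _ => by rw [prodExp_const hw]
    · simp only [Fin.cons_succ]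
      rw [← Finset.sum_mul, hw, one_mul, ih]

end ProdExp

/-! ### Sparse random signs -/

section SparseSigns

/-- The law of a sparse random sign: zero with probability `1 - q`, and each of the two signs with
probability `q / 2`. -/
noncomputable def signWeight (q : ℝ) : Option Bool → ℝ
  | none => 1 - q
  | some _ => q / 2

/-- The value of a sparse sign. -/
def signVal : Option Bool → ℝ
  | none => 0
  | some true => 1
  | some false => -1

@[simp] theorem signVal_none : signVal none = 0 := rfl

@[simp] theorem signVal_true : signVal (some true) = 1 := rfl

@[simp] theorem signVal_false : signVal (some false) = -1 := rfl

theorem sum_signWeight (q : ℝ) (F : Option Bool → ℝ) :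
    ∑ a, signWeight q a * F a =
      (1 - q) * F none + q / 2 * F (some true) + q / 2 * F (some false) := by
  simp [Fintype.sum_option, signWeight]
  ring

theorem signWeight_nonneg {q : ℝ} (h0 : 0 ≤ q) (h1 : q ≤ 1) (a : Option Bool) :
    0 ≤ signWeight q a := by
  cases a
  · simp only [signWeight]; linarith
  · simp only [signWeight]; linarith

theorem sum_signWeight_eq_one (q : ℝ) : ∑ a, signWeight q a = 1 := by
  have := sum_signWeight q fun _ => 1
  simp only [mul_one] at this
  rw [this]; ring

theorem signVal_sq_le_one (a : Option Bool) : signVal a ^ 2 ≤ 1 := by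
  rcases a with _ | _ | _ <;> simp [signVal]

theorem prodExp_sq_sum_signVal (q : ℝ) {n : ℕ} (a : Fin n → ℝ) :
    prodExp (signWeight q) (fun ξ => (∑ j, signVal (ξ j) * a j) ^ 2) = q * ∑ j, a j ^ 2 := by
  induction n with
  | zero => simp [prodExp_zero]
  | succ n ih =>
    rw [prodExp_succ, sum_signWeight]
    simp only [Fin.sum_univ_succ, Fin.cons_zero, Fin.cons_succ, signVal_none, signVal_true,
      signVal_false]
    have e : ∀ c : ℝ, prodExp (signWeight q)
        (fun ξ : Fin n → Option Bool => (c * a 0 + ∑ j, signVal (ξ j) * a j.succ) ^ 2) =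
        (c * a 0) ^ 2 + 2 * (c * a 0) * prodExp (signWeight q)
          (fun ξ : Fin n → Option Bool => ∑ j, signVal (ξ j) * a j.succ) +
          q * ∑ j : Fin n, a j.succ ^ 2 := by
      intro c
      rw [← ih, ← prodExp_const_mul,
        ← prodExp_const (n := n) (sum_signWeight_eq_one q) ((c * a 0) ^ 2), ← prodExp_add, ← prodExp_add]
      exact congrArg _ (funext fun ξ => by ring)
    rw [e, e, e]
    ring

theorem prodExp_sum_sq_signVal (q : ℝ) {n : ℕ} (a : Fin n → ℝ) :
    prodExp (signWeight q) (fun ξ => ∑ j, (signVal (ξ j) * a j) ^ 2) = q * ∑ j, a j ^ 2 := by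
  rw [prodExp_sum, Finset.mul_sum]
  refine Finset.sum_congr rfl fun j _ => ?_
  rw [prodExp_coord (sum_signWeight_eq_one q) j fun t => (signVal t * a j) ^ 2, sum_signWeight]
  simp only [signVal]
  ring

/-- The second moment of the off-diagonal bilinear form `∑_{j ≠ k} ξⱼ ξₖ αⱼ aₖ`. -/
theorem prodExp_offDiag_sq_le {q : ℝ} (h0 : 0 ≤ q) (h1 : q ≤ 1) {n : ℕ} (α a : Fin n → ℝ) :
    prodExp (signWeight q) (fun ξ => ((∑ j, signVal (ξ j) * α j) * (∑ j, signVal (ξ j) * a j) -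
      ∑ j, (signVal (ξ j) * α j) * (signVal (ξ j) * a j)) ^ 2) ≤
      2 * q ^ 2 * ((∑ j, α j ^ 2) * ∑ j, a j ^ 2) := by
  induction n with
  | zero => simp [prodExp_zero]
  | succ n ih =>
    rw [prodExp_succ, sum_signWeight]
    simp only [Fin.sum_univ_succ, Fin.cons_zero, Fin.cons_succ, signVal_none, signVal_true,
      signVal_false]
    -- with the first sign `c` split off, the form is `Q + c (α₀ S + a₀ T)`
    set A := ∑ j : Fin n, α j.succ ^ 2
    set B := ∑ j : Fin n, a j.succ ^ 2
    have hA : 0 ≤ A := Finset.sum_nonneg fun _ _ => sq_nonneg _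
    have hB : 0 ≤ B := Finset.sum_nonneg fun _ _ => sq_nonneg _
    let S : (Fin n → Option Bool) → ℝ := fun ξ => ∑ j, signVal (ξ j) * a j.succ
    let T : (Fin n → Option Bool) → ℝ := fun ξ => ∑ j, signVal (ξ j) * α j.succ
    let Q : (Fin n → Option Bool) → ℝ := fun ξ => T ξ * S ξ -
      ∑ j, (signVal (ξ j) * α j.succ) * (signVal (ξ j) * a j.succ)
    have hQ : prodExp (signWeight q) (fun ξ => Q ξ ^ 2) ≤ 2 * q ^ 2 * (A * B) := ih _ _
    have hS : prodExp (signWeight q) (fun ξ => S ξ ^ 2) = q * B := prodExp_sq_sum_signVal q _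
    have hT : prodExp (signWeight q) (fun ξ => T ξ ^ 2) = q * A := prodExp_sq_sum_signVal q _
    have key : prodExp (signWeight q) (fun ξ => (α 0 * S ξ + a 0 * T ξ) ^ 2) ≤
        2 * q * (α 0 ^ 2 * B + a 0 ^ 2 * A) := by
      calc prodExp (signWeight q) (fun ξ => (α 0 * S ξ + a 0 * T ξ) ^ 2)
          ≤ prodExp (signWeight q)
              (fun ξ => 2 * α 0 ^ 2 * S ξ ^ 2 + 2 * a 0 ^ 2 * T ξ ^ 2) :=
            prodExp_mono (signWeight_nonneg h0 h1) fun ξ => by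
              nlinarith [sq_nonneg (α 0 * S ξ - a 0 * T ξ)]
        _ = _ := by rw [prodExp_add, prodExp_const_mul, prodExp_const_mul, hS, hT]; ring
    have e : ∀ c : ℝ, prodExp (signWeight q) (fun ξ : Fin n → Option Bool =>
        ((c * α 0 + ∑ j, signVal (ξ j) * α j.succ) * (c * a 0 + ∑ j, signVal (ξ j) * a j.succ) -
          (c * α 0 * (c * a 0) +
            ∑ j, signVal (ξ j) * α j.succ * (signVal (ξ j) * a j.succ))) ^ 2) =
        prodExp (signWeight q) (fun ξ => Q ξ ^ 2) +
        2 * c * prodExp (signWeight q) (fun ξ => Q ξ * (α 0 * S ξ + a 0 * T ξ)) +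
        c ^ 2 * prodExp (signWeight q) (fun ξ => (α 0 * S ξ + a 0 * T ξ) ^ 2) := by
      intro c
      rw [← prodExp_const_mul, ← prodExp_const_mul, ← prodExp_add, ← prodExp_add]
      refine congrArg _ (funext fun ξ => ?_)
      simp only [Q, S, T]
      ring
    rw [e 0, e 1, e (-1)]
    nlinarith [mul_le_mul_of_nonneg_left key h0, mul_nonneg (sq_nonneg q)
      (mul_nonneg (sq_nonneg (α 0)) (sq_nonneg (a 0)))]

end SparseSigns

/-! ### Exponential moments of the norm of a sparse Rademacher sum -/

section NormMoment

/-- Convexity of the power function, for a pair `(a, b)` less spread out than `(c, d)`. -/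
theorem pow_add_pow_le_of_add_eq {a b c d : ℝ} (hd : 0 ≤ d) (ha : d ≤ a) (hac : a ≤ c)
    (h : a + b = c + d) (k : ℕ) : a ^ k + b ^ k ≤ c ^ k + d ^ k := by
  rcases eq_or_lt_of_le (ha.trans hac) with hdc | hdc
  · have h1 : a = c := le_antisymm hac (hdc ▸ ha)
    have h2 : b = d := by linarith
    rw [h1, h2]
  · have hpos : 0 < c - d := by linarith
    set t := (a - d) / (c - d) with ht
    have ht0 : 0 ≤ t := div_nonneg (by linarith) hpos.le
    have ht1 : 0 ≤ 1 - t := by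
      have : t ≤ 1 := (div_le_one hpos).2 (by linarith)
      linarith
    have hta : t * (c - d) = a - d := div_mul_cancel₀ _ hpos.ne'
    have hconv := convexOn_pow (𝕜 := ℝ) k
    have e1 := hconv.2 (x := c) (y := d) (by simp only [Set.mem_Ici]; linarith) hd ht0 ht1 (by ring)
    have e2 := hconv.2 (x := c) (y := d) (by simp only [Set.mem_Ici]; linarith) hd ht1 ht0 (by ring)
    simp only [smul_eq_mul] at e1 e2
    rw [show t * c + (1 - t) * d = a by linarith] at e1
    rw [show (1 - t) * c + t * d = b by linarith] at e2
    linarith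

/-- Convexity of `t ↦ cosh √t`, in the form of a two-point inequality. -/
theorem cosh_add_cosh_le_of_sq_add_sq_eq {a b c d : ℝ} (hd : d ^ 2 ≤ a ^ 2) (hac : a ^ 2 ≤ c ^ 2)
    (h : a ^ 2 + b ^ 2 = c ^ 2 + d ^ 2) :
    Real.cosh a + Real.cosh b ≤ Real.cosh c + Real.cosh d := by
  refine hasSum_le (fun k => ?_) ((Real.hasSum_cosh a).add (Real.hasSum_cosh b))
    ((Real.hasSum_cosh c).add (Real.hasSum_cosh d))
  rw [← add_div, ← add_div, pow_mul, pow_mul, pow_mul, pow_mul]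
  exact div_le_div_of_nonneg_right (pow_add_pow_le_of_add_eq (sq_nonneg d) hd hac h k)
    (Nat.cast_nonneg _)

theorem cosh_mul_le {s x : ℝ} (hx : x ^ 2 ≤ 1) :
    Real.cosh (s * x) ≤ 1 + x ^ 2 * (Real.cosh s - 1) := by
  have h1 : HasSum (fun k : ℕ => if k = 0 then 1 - x ^ 2 else 0) (1 - x ^ 2) :=
    hasSum_ite_eq 0 _
  have h2 := h1.add ((Real.hasSum_cosh s).mul_left (x ^ 2))
  rw [show 1 + x ^ 2 * (Real.cosh s - 1) = 1 - x ^ 2 + x ^ 2 * Real.cosh s by ring]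
  refine hasSum_le (fun k => ?_) (Real.hasSum_cosh (s * x)) h2
  rcases k with _ | k
  · simp
  · simp only [Nat.add_eq_zero_iff, one_ne_zero, and_false, if_false, zero_add]
    rw [mul_pow, mul_comm, mul_div_assoc]
    refine mul_le_mul_of_nonneg_right ?_ ?_
    · rw [pow_mul, pow_succ]
      exact mul_le_of_le_one_left (sq_nonneg x) (pow_le_one₀ (sq_nonneg x) hx)
    · rw [pow_mul]; positivity

variable {E : Type*} [NormedAddCommGroup E] [InnerProductSpace ℝ E]

/-- In an inner product space the worst case for the two-point average of `cosh ‖·‖` is that of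
parallel vectors. -/
theorem cosh_norm_add_add_cosh_norm_sub_le (x y : E) :
    Real.cosh ‖x + y‖ + Real.cosh ‖x - y‖ ≤ 2 * (Real.cosh ‖x‖ * Real.cosh ‖y‖) := by
  have h := cosh_add_cosh_le_of_sq_add_sq_eq (a := ‖x + y‖) (b := ‖x - y‖) (c := ‖x‖ + ‖y‖)
    (d := ‖x‖ - ‖y‖) ?_ ?_ ?_
  · rw [Real.cosh_add, Real.cosh_sub] at h
    linarith
  · have := abs_norm_sub_norm_le x (-y)
    rw [norm_neg, sub_neg_eq_add] at this
    exact sq_le_sq.2 (this.trans (le_abs_self _))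
  · exact pow_le_pow_left₀ (norm_nonneg _) (norm_add_le x y) 2
  · have := parallelogram_law_with_norm ℝ x y
    nlinarith

theorem prodExp_cosh_norm_le {q : ℝ} (h0 : 0 ≤ q) (h1 : q ≤ 1) {n : ℕ} (u : Fin n → E) (y : E) :
    prodExp (signWeight q) (fun ξ => Real.cosh ‖y + ∑ j, signVal (ξ j) • u j‖) ≤
      Real.cosh ‖y‖ * ∏ j, (1 + q * (Real.cosh ‖u j‖ - 1)) := by
  induction n generalizing y with
  | zero => simp [prodExp_zero]
  | succ n ih =>
    rw [prodExp_succ, sum_signWeight]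
    simp only [Fin.sum_univ_succ, Fin.cons_zero, Fin.cons_succ, signVal_none, signVal_true,
      signVal_false, Fin.prod_univ_succ, ← add_assoc, zero_smul, add_zero, one_smul, neg_smul,
      ← sub_eq_add_neg]
    set pr := ∏ j : Fin n, (1 + q * (Real.cosh ‖u j.succ‖ - 1)) with hpr
    have hpr0 : 0 ≤ pr := Finset.prod_nonneg fun j _ => by
      have := Real.one_le_cosh ‖u j.succ‖
      have : 0 ≤ q * (Real.cosh ‖u j.succ‖ - 1) := mul_nonneg h0 (by linarith)
      linarith
    have i1 := ih (fun j => u j.succ) y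
    have i2 := ih (fun j => u j.succ) (y + u 0)
    have i3 := ih (fun j => u j.succ) (y - u 0)
    rw [← hpr] at i1 i2 i3
    have hc := mul_le_mul_of_nonneg_right (cosh_norm_add_add_cosh_norm_sub_le y (u 0)) hpr0
    have j1 := mul_le_mul_of_nonneg_left i1 (show 0 ≤ 1 - q by linarith)
    have j2 := mul_le_mul_of_nonneg_left i2 (show 0 ≤ q / 2 by linarith)
    have j3 := mul_le_mul_of_nonneg_left i3 (show 0 ≤ q / 2 by linarith)
    have j4 := mul_le_mul_of_nonneg_left hc (show 0 ≤ q / 2 by linarith)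
    calc _ ≤ (1 - q) * (Real.cosh ‖y‖ * pr) + q / 2 * (Real.cosh ‖y + u 0‖ * pr) +
          q / 2 * (Real.cosh ‖y - u 0‖ * pr) := by linarith
      _ ≤ _ := by linarith

/-- Tail bound for the norm of a sparse Rademacher sum of vectors of norm at most one. -/
theorem prodExp_norm_gt_le {q : ℝ} (h0 : 0 ≤ q) (h1 : q ≤ 1) {n : ℕ} (u : Fin n → E)
    (hu : ∀ j, ‖u j‖ ≤ 1) {D s r : ℝ} (hD : ∑ j, ‖u j‖ ^ 2 ≤ D) (hs : 0 ≤ s) :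
    prodExp (signWeight q) (fun ξ => if r < ‖∑ j, signVal (ξ j) • u j‖ then 1 else 0) ≤
      2 * Real.exp (q * D * Real.exp s - s * r) := by
  have hD0 : 0 ≤ D := le_trans (Finset.sum_nonneg fun _ _ => sq_nonneg _) hD
  have hcosh : prodExp (signWeight q)
      (fun ξ => Real.cosh (s * ‖∑ j, signVal (ξ j) • u j‖)) ≤ Real.exp (q * D * Real.exp s) := by
    have h := prodExp_cosh_norm_le h0 h1 (fun j => s • u j) 0
    have e : ∀ ξ : Fin n → Option Bool, ‖(0 : E) + ∑ j, signVal (ξ j) • s • u j‖ =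
        s * ‖∑ j, signVal (ξ j) • u j‖ := by
      intro ξ
      rw [zero_add, ← abs_of_nonneg hs, ← Real.norm_eq_abs, ← norm_smul, Finset.smul_sum,
        Real.norm_eq_abs, abs_of_nonneg hs]
      exact congrArg _ (Finset.sum_congr rfl fun j _ => smul_comm _ _ _)
    simp only [e, norm_zero, Real.cosh_zero, one_mul] at h
    refine h.trans ?_
    have hc1 : 0 ≤ Real.cosh s - 1 := by linarith [Real.one_le_cosh s]
    have hb : ∀ j, 1 + q * (Real.cosh ‖s • u j‖ - 1) ≤
        Real.exp (q * (‖u j‖ ^ 2 * (Real.cosh s - 1))) := by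
      intro j
      rw [norm_smul, Real.norm_eq_abs, abs_of_nonneg hs]
      have h2 := cosh_mul_le (s := s) (x := ‖u j‖) (pow_le_one₀ (norm_nonneg _) (hu j))
      have h3 : q * (Real.cosh (s * ‖u j‖) - 1) ≤ q * (‖u j‖ ^ 2 * (Real.cosh s - 1)) :=
        mul_le_mul_of_nonneg_left (by linarith) h0
      linarith [Real.add_one_le_exp (q * (‖u j‖ ^ 2 * (Real.cosh s - 1)))]
    refine (Finset.prod_le_prod (fun j _ => ?_) fun j _ => hb j).trans ?_
    · have := Real.one_le_cosh ‖s • u j‖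
      have : 0 ≤ q * (Real.cosh ‖s • u j‖ - 1) := mul_nonneg h0 (by linarith)
      linarith
    · rw [← Real.exp_sum, ← Finset.mul_sum, ← Finset.sum_mul, Real.exp_le_exp, mul_assoc]
      refine mul_le_mul_of_nonneg_left (mul_le_mul hD ?_ hc1 hD0) h0
      have := Real.cosh_eq s
      have h5 : Real.exp (-s) ≤ Real.exp s := Real.exp_le_exp.2 (by linarith)
      linarith
  calc prodExp (signWeight q) (fun ξ => if r < ‖∑ j, signVal (ξ j) • u j‖ then 1 else 0)
      ≤ prodExp (signWeight q) (fun ξ => (2 * Real.exp (-(s * r))) *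
          Real.cosh (s * ‖∑ j, signVal (ξ j) • u j‖)) := by
        refine prodExp_mono (signWeight_nonneg h0 h1) fun ξ => ?_
        split_ifs with hlt
        · have h2 : Real.exp (s * r) ≤ Real.exp (s * ‖∑ j, signVal (ξ j) • u j‖) :=
            Real.exp_le_exp.2 (mul_le_mul_of_nonneg_left hlt.le hs)
          have h3 : Real.exp (s * r) ≤ 2 * Real.cosh (s * ‖∑ j, signVal (ξ j) • u j‖) := by
            rw [Real.cosh_eq]
            have := Real.exp_pos (-(s * ‖∑ j, signVal (ξ j) • u j‖))
            linarith
          have h4 : Real.exp (-(s * r)) * Real.exp (s * r) = 1 := by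
            rw [← Real.exp_add]; simp
          nlinarith [mul_le_mul_of_nonneg_left h3 (Real.exp_pos (-(s * r))).le]
        · exact mul_nonneg (by positivity) (Real.cosh_pos _).le
    _ ≤ (2 * Real.exp (-(s * r))) * Real.exp (q * D * Real.exp s) := by
        rw [prodExp_const_mul]
        exact mul_le_mul_of_nonneg_left hcosh (by positivity)
    _ = _ := by rw [mul_assoc, ← Real.exp_add]; ring_nf

end NormMoment

/-! ### The contribution of one bucket -/

section Bucket

open NormedSpace

variable {n d : ℕ}

/-- The matrix `U` does not increase the Euclidean norm. -/
def IsContraction (U : Matrix (Fin n) (Fin d) ℝ) : Prop :=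
  ∀ x : Fin d → ℝ, (U *ᵥ x) ⬝ᵥ (U *ᵥ x) ≤ x ⬝ᵥ x

/-- The matrix whose `j`-th row is `a j` times the `j`-th row of `U`. -/
def rowScale (a : Fin n → ℝ) (U : Matrix (Fin n) (Fin d) ℝ) : Matrix (Fin n) (Fin d) ℝ :=
  Matrix.of fun j c => a j * U j c

/-- The sum of the rows of `V`. -/
def rowSum (V : Matrix (Fin n) (Fin d) ℝ) : Fin d → ℝ := fun c => ∑ j, V j c

/-- The off-diagonal part `∑_{j ≠ k} Vⱼ Vₖᵀ` of `(∑ Vⱼ) (∑ Vⱼ)ᵀ`, where `Vⱼ` is the `j`-th row of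
`V`. -/
def offDiagGram (V : Matrix (Fin n) (Fin d) ℝ) : Matrix (Fin d) (Fin d) ℝ :=
  Matrix.vecMulVec (rowSum V) (rowSum V) - Vᵀ * V

theorem isSymm_offDiagGram (V : Matrix (Fin n) (Fin d) ℝ) : (offDiagGram V).IsSymm := by
  unfold offDiagGram
  rw [Matrix.IsSymm, Matrix.transpose_sub, Matrix.transpose_mul, Matrix.transpose_transpose,
    Matrix.transpose_vecMulVec]

theorem offDiagGram_mulVec (V : Matrix (Fin n) (Fin d) ℝ) (x : Fin d → ℝ) (c : Fin d) :
    (offDiagGram V *ᵥ x) c =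
      (∑ j, V j c) * (∑ j, (V *ᵥ x) j) - ∑ j, V j c * (V *ᵥ x) j := by
  have e1 : rowSum V ⬝ᵥ x = ∑ j, (V *ᵥ x) j := by
    simp only [rowSum, dotProduct, Matrix.mulVec, Finset.sum_mul]
    exact Finset.sum_comm
  rw [offDiagGram, Matrix.sub_mulVec, Matrix.vecMulVec_mulVec, ← Matrix.mulVec_mulVec, e1]
  change (∑ j, V j c) * _ - _ = _
  rfl

theorem dotProduct_offDiagGram (V : Matrix (Fin n) (Fin d) ℝ) (x : Fin d → ℝ) :
    x ⬝ᵥ offDiagGram V *ᵥ x = (rowSum V ⬝ᵥ x) ^ 2 - (V *ᵥ x) ⬝ᵥ (V *ᵥ x) := by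
  rw [offDiagGram, Matrix.sub_mulVec, dotProduct_sub, Matrix.vecMulVec_mulVec,
    ← Matrix.mulVec_mulVec, Matrix.dotProduct_mulVec x Vᵀ, Matrix.vecMul_transpose]
  simp [dotProduct_comm x, pow_two]

theorem rowScale_mulVec (a : Fin n → ℝ) (U : Matrix (Fin n) (Fin d) ℝ) (x : Fin d → ℝ)
    (j : Fin n) : (rowScale a U *ᵥ x) j = a j * (U *ᵥ x) j := by
  simp [rowScale, Matrix.mulVec, dotProduct, Finset.mul_sum, mul_assoc]

theorem IsContraction.rowScale {U : Matrix (Fin n) (Fin d) ℝ} (hU : IsContraction U)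
    {a : Fin n → ℝ} (ha : ∀ j, a j ^ 2 ≤ 1) : IsContraction (rowScale a U) := by
  intro x
  refine le_trans (Finset.sum_le_sum fun j _ => ?_) (hU x)
  rw [rowScale_mulVec]
  nlinarith [mul_le_mul_of_nonneg_right (ha j) (sq_nonneg ((U *ᵥ x) j))]

theorem dotProduct_self_nonneg_real {ι : Type*} [Fintype ι] (x : ι → ℝ) : 0 ≤ x ⬝ᵥ x :=
  Finset.sum_nonneg fun _ _ => mul_self_nonneg _

theorem IsContraction.row_le_one {U : Matrix (Fin n) (Fin d) ℝ} (hU : IsContraction U)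
    (j : Fin n) : U j ⬝ᵥ U j ≤ 1 := by
  have h1 : (U j ⬝ᵥ U j) * (U j ⬝ᵥ U j) ≤ U j ⬝ᵥ U j :=
    le_trans (Finset.single_le_sum (f := fun k => (U *ᵥ U j) k * (U *ᵥ U j) k)
      (fun k _ => mul_self_nonneg _) (Finset.mem_univ j)) (hU (U j))
  by_contra! h
  nlinarith

/-- The squared Frobenius norm of a contraction is at most the number of columns. -/
theorem IsContraction.sum_row_le {U : Matrix (Fin n) (Fin d) ℝ} (hU : IsContraction U) :
    ∑ c, ∑ j, U j c ^ 2 ≤ d := by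
  have h : ∀ c, ∑ j, U j c ^ 2 ≤ 1 := by
    intro c
    have := hU (Pi.single c 1)
    rw [Matrix.mulVec_single_one] at this
    simpa [dotProduct, pow_two, Pi.single_apply] using this
  calc _ ≤ ∑ _c : Fin d, (1 : ℝ) := Finset.sum_le_sum fun c _ => h c
    _ = d := by simp

theorem sq_dotProduct_le {ι : Type*} [Fintype ι] (x y : ι → ℝ) :
    (x ⬝ᵥ y) ^ 2 ≤ (x ⬝ᵥ x) * (y ⬝ᵥ y) := by
  simpa [dotProduct, pow_two] using Finset.sum_mul_sq_le_sq_mul_sq Finset.univ x y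

/-- The rows of `U` multiplied by sparse signs. -/
def signRows (U : Matrix (Fin n) (Fin d) ℝ) (ξ : Fin n → Option Bool) :
    Matrix (Fin n) (Fin d) ℝ :=
  rowScale (fun j => signVal (ξ j)) U

theorem rowSum_signRows_dotProduct (U : Matrix (Fin n) (Fin d) ℝ) (ξ : Fin n → Option Bool)
    (x : Fin d → ℝ) : rowSum (signRows U ξ) ⬝ᵥ x = ∑ j, signVal (ξ j) * (U *ᵥ x) j := by
  simp only [rowSum, signRows, rowScale, Matrix.of_apply, dotProduct, Matrix.mulVec,
    Finset.sum_mul, Finset.mul_sum, mul_assoc]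
  exact Finset.sum_comm

variable {U : Matrix (Fin n) (Fin d) ℝ}

theorem neg_le_dotProduct_offDiagGram (hU : IsContraction U) (ξ : Fin n → Option Bool)
    (x : Fin d → ℝ) : -(x ⬝ᵥ x) ≤ x ⬝ᵥ offDiagGram (signRows U ξ) *ᵥ x := by
  rw [dotProduct_offDiagGram]
  have := hU.rowScale (a := fun j => signVal (ξ j)) (fun j => signVal_sq_le_one _) x
  rw [signRows]
  nlinarith [sq_nonneg (rowSum (rowScale (fun j => signVal (ξ j)) U) ⬝ᵥ x)]

theorem dotProduct_offDiagGram_le (V : Matrix (Fin n) (Fin d) ℝ) (x : Fin d → ℝ) :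
    x ⬝ᵥ offDiagGram V *ᵥ x ≤ (rowSum V ⬝ᵥ rowSum V) * (x ⬝ᵥ x) := by
  rw [dotProduct_offDiagGram]
  linarith [sq_dotProduct_le (rowSum V) x, dotProduct_self_nonneg_real (V *ᵥ x)]

theorem prodExp_dotProduct_offDiagGram (q : ℝ) (x : Fin d → ℝ) :
    prodExp (signWeight q) (fun ξ => x ⬝ᵥ offDiagGram (signRows U ξ) *ᵥ x) = 0 := by
  have e : ∀ ξ, x ⬝ᵥ offDiagGram (signRows U ξ) *ᵥ x =
      (∑ j, signVal (ξ j) * (U *ᵥ x) j) ^ 2 - ∑ j, (signVal (ξ j) * (U *ᵥ x) j) ^ 2 := by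
    intro ξ
    rw [dotProduct_offDiagGram, rowSum_signRows_dotProduct]
    congr 1
    exact Finset.sum_congr rfl fun j _ => by rw [signRows, rowScale_mulVec, pow_two]
  simp only [e]
  rw [prodExp_sub, prodExp_sq_sum_signVal, prodExp_sum_sq_signVal, sub_self]

/-- The variance proxy of a bucket. -/
theorem prodExp_offDiagGram_mulVec_sq_le (hU : IsContraction U) {q : ℝ} (h0 : 0 ≤ q)
    (h1 : q ≤ 1) (x : Fin d → ℝ) :
    prodExp (signWeight q) (fun ξ => (offDiagGram (signRows U ξ) *ᵥ x) ⬝ᵥ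
      (offDiagGram (signRows U ξ) *ᵥ x)) ≤ 2 * q ^ 2 * d * (x ⬝ᵥ x) := by
  simp only [dotProduct]
  rw [prodExp_sum]
  have hc : ∀ c, prodExp (signWeight q) (fun ξ => (offDiagGram (signRows U ξ) *ᵥ x) c *
      (offDiagGram (signRows U ξ) *ᵥ x) c) ≤
      2 * q ^ 2 * ((∑ j, U j c ^ 2) * ∑ j, (U *ᵥ x) j ^ 2) := by
    intro c
    refine le_trans (le_of_eq ?_) (prodExp_offDiag_sq_le h0 h1 (fun j => U j c) (U *ᵥ x))
    refine congrArg _ (funext fun ξ => ?_)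
    rw [offDiagGram_mulVec, ← pow_two]
    simp only [signRows, rowScale_mulVec]
    rfl
  refine (Finset.sum_le_sum fun c _ => hc c).trans ?_
  rw [← Finset.mul_sum, ← Finset.sum_mul, mul_assoc (2 * q ^ 2)]
  refine mul_le_mul_of_nonneg_left (mul_le_mul hU.sum_row_le ?_ ?_ (Nat.cast_nonneg _))
    (by positivity)
  · have := hU x
    simpa only [dotProduct, ← pow_two] using this
  · exact Finset.sum_nonneg fun _ _ => sq_nonneg _

/-- A bucket is unlikely to be long. -/
theorem prodExp_rowSum_gt_le (hU : IsContraction U) {q s r : ℝ} (h0 : 0 ≤ q) (h1 : q ≤ 1)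
    (hs : 0 ≤ s) (hr : 0 ≤ r) :
    prodExp (signWeight q) (fun ξ => if r ^ 2 < rowSum (signRows U ξ) ⬝ᵥ rowSum (signRows U ξ)
      then 1 else 0) ≤ 2 * Real.exp (q * d * Real.exp s - s * r) := by
  let u : Fin n → EuclideanSpace ℝ (Fin d) := fun j => WithLp.toLp 2 (U j)
  have hu : ∀ j, ‖u j‖ ^ 2 = U j ⬝ᵥ U j := by
    intro j
    rw [EuclideanSpace.norm_sq_eq]
    simp [u, dotProduct, pow_two]
  have hv : ∀ ξ : Fin n → Option Bool, ‖∑ j, signVal (ξ j) • u j‖ ^ 2 =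
      rowSum (signRows U ξ) ⬝ᵥ rowSum (signRows U ξ) := by
    intro ξ
    rw [EuclideanSpace.norm_sq_eq]
    simp [u, dotProduct, pow_two, rowSum, signRows, rowScale]
  have h := prodExp_norm_gt_le h0 h1 u (fun j => ?_) (D := d) (s := s) (r := r) ?_ hs
  · refine le_trans (le_of_eq (congrArg _ (funext fun ξ => ?_))) h
    rw [← hv]
    exact if_congr (pow_lt_pow_iff_left₀ hr (norm_nonneg _) two_ne_zero) rfl rfl
  · have := hU.row_le_one j
    rw [← hu] at this
    exact (pow_le_one_iff_of_nonneg (norm_nonneg _) two_ne_zero).1 this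
  · simp only [hu, dotProduct, ← pow_two]
    rw [Finset.sum_comm]
    exact hU.sum_row_le

/-- `lam` times the off-diagonal Gram matrix, discarded when the row sum is longer than `r`. -/
noncomputable def truncGram (lam r : ℝ) (V : Matrix (Fin n) (Fin d) ℝ) :
    Matrix (Fin d) (Fin d) ℝ :=
  open Classical in if r ^ 2 < rowSum V ⬝ᵥ rowSum V then 0 else lam • offDiagGram V

theorem isSymm_truncGram (lam r : ℝ) (V : Matrix (Fin n) (Fin d) ℝ) :
    (truncGram lam r V).IsSymm := by
  unfold truncGram
  split_ifs
  · exact Matrix.isSymm_zero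
  · exact (isSymm_offDiagGram V).smul _

/-- Exponential moment of a truncated bucket. -/
theorem prodExp_exp_truncGram_le (hU : IsContraction U) {q q₀ lam s r : ℝ} (h0 : 0 ≤ q)
    (hq : q ≤ q₀) (h1 : q ≤ 1) (hlam : 0 ≤ lam) (hs : 0 ≤ s) (hr : 0 ≤ r) (x : Fin d → ℝ) :
    prodExp (signWeight q) (fun ξ => x ⬝ᵥ exp (truncGram lam r (signRows U ξ)) *ᵥ x) ≤
      (1 + (lam * (2 * Real.exp (q₀ * d * Real.exp s - s * r)) +
        lam ^ 2 * Real.exp (lam * r ^ 2) * (2 * q₀ ^ 2 * d))) * (x ⬝ᵥ x) := by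
  have hxx := dotProduct_self_nonneg_real x
  set W : (Fin n → Option Bool) → Matrix (Fin d) (Fin d) ℝ :=
    fun ξ => offDiagGram (signRows U ξ) with hW
  set I : (Fin n → Option Bool) → ℝ := fun ξ =>
    if r ^ 2 < rowSum (signRows U ξ) ⬝ᵥ rowSum (signRows U ξ) then 1 else 0 with hI
  -- discarding a bucket costs at most `lam * (x ⬝ᵥ x)`, since `offDiagGram` is at least `-1`
  have hpt : ∀ ξ, x ⬝ᵥ exp (truncGram lam r (signRows U ξ)) *ᵥ x ≤
      x ⬝ᵥ x + (lam * (x ⬝ᵥ W ξ *ᵥ x) + (lam * (x ⬝ᵥ x)) * I ξ +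
        (Real.exp (lam * r ^ 2) * lam ^ 2) * ((W ξ *ᵥ x) ⬝ᵥ (W ξ *ᵥ x))) := by
    intro ξ
    have hWsq := dotProduct_self_nonneg_real (W ξ *ᵥ x)
    have hM : 0 ≤ lam * r ^ 2 := by positivity
    have hup : ∀ y, y ⬝ᵥ truncGram lam r (signRows U ξ) *ᵥ y ≤ lam * r ^ 2 * (y ⬝ᵥ y) := by
      intro y
      have hyy := dotProduct_self_nonneg_real y
      unfold truncGram
      split_ifs with hgt
      · simp only [Matrix.zero_mulVec, dotProduct_zero]
        positivity
      · rw [Matrix.smul_mulVec, dotProduct_smul, smul_eq_mul, mul_assoc]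
        refine mul_le_mul_of_nonneg_left ((dotProduct_offDiagGram_le _ y).trans ?_) hlam
        exact mul_le_mul_of_nonneg_right (not_lt.1 hgt) hyy
    refine (dotProduct_exp_le (isSymm_truncGram _ _ _) hM hup x).trans ?_
    have hneg := neg_le_dotProduct_offDiagGram hU ξ x
    have hE := Real.exp_pos (lam * r ^ 2)
    have hpos : 0 ≤ Real.exp (lam * r ^ 2) * lam ^ 2 * ((W ξ *ᵥ x) ⬝ᵥ (W ξ *ᵥ x)) := by positivity
    simp only [hI, truncGram]
    split_ifs with hgt
    · simp only [Matrix.zero_mulVec, dotProduct_zero]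
      have := mul_le_mul_of_nonneg_left hneg hlam
      linarith
    · simp only [Matrix.smul_mulVec, dotProduct_smul, smul_dotProduct, smul_eq_mul]
      linarith
  have hq2 : 2 * q ^ 2 * d ≤ 2 * q₀ ^ 2 * d := by gcongr
  have htail : prodExp (signWeight q) I ≤ 2 * Real.exp (q₀ * d * Real.exp s - s * r) := by
    refine (prodExp_rowSum_gt_le hU h0 h1 hs hr).trans ?_
    gcongr
  have hvar : prodExp (signWeight q) (fun ξ => (W ξ *ᵥ x) ⬝ᵥ (W ξ *ᵥ x)) ≤
      2 * q₀ ^ 2 * d * (x ⬝ᵥ x) :=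
    (prodExp_offDiagGram_mulVec_sq_le hU h0 h1 x).trans (mul_le_mul_of_nonneg_right hq2 hxx)
  refine (prodExp_mono (signWeight_nonneg h0 h1) hpt).trans ?_
  rw [prodExp_add, prodExp_add, prodExp_add, prodExp_const (sum_signWeight_eq_one q),
    prodExp_const_mul, prodExp_const_mul, prodExp_const_mul, hW, prodExp_dotProduct_offDiagGram]
  have m1 := mul_le_mul_of_nonneg_left htail (mul_nonneg hlam hxx)
  have m2 := mul_le_mul_of_nonneg_left hvar
    (show 0 ≤ Real.exp (lam * r ^ 2) * lam ^ 2 by positivity)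
  nlinarith

/-- Exponential moment of a negated bucket; no truncation is needed since the off-diagonal Gram
matrix is bounded below by `-1`. -/
theorem prodExp_exp_neg_offDiagGram_le (hU : IsContraction U) {q q₀ lam : ℝ} (h0 : 0 ≤ q)
    (hq : q ≤ q₀) (h1 : q ≤ 1) (hlam : 0 ≤ lam) (x : Fin d → ℝ) :
    prodExp (signWeight q) (fun ξ => x ⬝ᵥ exp ((-lam) • offDiagGram (signRows U ξ)) *ᵥ x) ≤
      (1 + lam ^ 2 * Real.exp lam * (2 * q₀ ^ 2 * d)) * (x ⬝ᵥ x) := by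
  have hxx := dotProduct_self_nonneg_real x
  set W : (Fin n → Option Bool) → Matrix (Fin d) (Fin d) ℝ :=
    fun ξ => offDiagGram (signRows U ξ) with hW
  have hpt : ∀ ξ, x ⬝ᵥ exp ((-lam) • offDiagGram (signRows U ξ)) *ᵥ x ≤
      x ⬝ᵥ x + ((-lam) * (x ⬝ᵥ W ξ *ᵥ x) +
        (Real.exp lam * lam ^ 2) * ((W ξ *ᵥ x) ⬝ᵥ (W ξ *ᵥ x))) := by
    intro ξ
    have hup : ∀ y, y ⬝ᵥ ((-lam) • offDiagGram (signRows U ξ)) *ᵥ y ≤ lam * (y ⬝ᵥ y) := by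
      intro y
      rw [Matrix.smul_mulVec, dotProduct_smul, smul_eq_mul]
      nlinarith [mul_le_mul_of_nonneg_left (neg_le_dotProduct_offDiagGram hU ξ y) hlam]
    refine (dotProduct_exp_le ((isSymm_offDiagGram _).smul _) hlam hup x).trans (le_of_eq ?_)
    simp only [Matrix.smul_mulVec, dotProduct_smul, smul_dotProduct, smul_eq_mul, hW]
    ring
  have hq2 : 2 * q ^ 2 * d ≤ 2 * q₀ ^ 2 * d := by gcongr
  have hvar : prodExp (signWeight q) (fun ξ => (W ξ *ᵥ x) ⬝ᵥ (W ξ *ᵥ x)) ≤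
      2 * q₀ ^ 2 * d * (x ⬝ᵥ x) :=
    (prodExp_offDiagGram_mulVec_sq_le hU h0 h1 x).trans (mul_le_mul_of_nonneg_right hq2 hxx)
  refine (prodExp_mono (signWeight_nonneg h0 h1) hpt).trans ?_
  rw [prodExp_add, prodExp_add, prodExp_const (sum_signWeight_eq_one q),
    prodExp_const_mul, prodExp_const_mul, hW, prodExp_dotProduct_offDiagGram]
  have m2 := mul_le_mul_of_nonneg_left hvar (show 0 ≤ Real.exp lam * lam ^ 2 by positivity)
  nlinarith

end Bucket

/-! ### Revealing the buckets of a Count-Sketch one at a time -/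

section Reveal

open NormedSpace

variable {n d : ℕ}

/-- One step of the matrix Laplace transform method. -/
theorem prodExp_trace_exp_add_le {α : Type*} [Fintype α] {w : α → ℝ} (hw : ∀ a, 0 ≤ w a)
    {Z : (Fin n → α) → Matrix (Fin d) (Fin d) ℝ} (hZ : ∀ ξ, (Z ξ).IsSymm) {A : ℝ}
    (hA : ∀ x : Fin d → ℝ, prodExp w (fun ξ => x ⬝ᵥ exp (Z ξ) *ᵥ x) ≤ A * (x ⬝ᵥ x))
    {Y : Matrix (Fin d) (Fin d) ℝ} (hY : Y.IsSymm) :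
    prodExp w (fun ξ => (exp (Y + Z ξ)).trace) ≤ A * (exp Y).trace := by
  obtain ⟨z, hz⟩ := exists_trace_exp_mul_eq hY
  have h1 := hz 1
  simp only [mul_one, Matrix.one_mulVec] at h1
  calc prodExp w (fun ξ => (exp (Y + Z ξ)).trace)
      ≤ prodExp w (fun ξ => ∑ i, z i ⬝ᵥ exp (Z ξ) *ᵥ z i) :=
        prodExp_mono hw fun ξ => (trace_exp_add_le hY (hZ ξ)).trans_eq (hz _)
    _ ≤ ∑ i, A * (z i ⬝ᵥ z i) := by
        rw [prodExp_sum]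
        exact Finset.sum_le_sum fun i _ => hA (z i)
    _ = _ := by rw [← Finset.mul_sum, h1]

theorem trace_exp_nonneg {Y : Matrix (Fin d) (Fin d) ℝ} (hY : Y.IsSymm) :
    0 ≤ (exp Y).trace := by
  obtain ⟨z, hz⟩ := exists_trace_exp_mul_eq hY
  have h1 := hz 1
  simp only [mul_one, Matrix.one_mulVec] at h1
  rw [h1]
  exact Finset.sum_nonneg fun i _ => dotProduct_self_nonneg_real _

/-- The uniform distribution on the column and the sign chosen by one row of a Count-Sketch. -/
noncomputable def seedWeight (b : ℕ) : Fin b × Bool → ℝ := fun _ => (2 * (b : ℝ))⁻¹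

theorem seedWeight_nonneg (b : ℕ) (p : Fin b × Bool) : 0 ≤ seedWeight b p := by
  unfold seedWeight; positivity

theorem sum_seedWeight {b : ℕ} (hb : 0 < b) : ∑ p, seedWeight b p = 1 := by
  have : (b : ℝ) ≠ 0 := by positivity
  simp [seedWeight, Finset.card_univ]
  field_simp

/-- What a row with choices `p` contributes to bucket `l`. -/
def hit {b : ℕ} (l : Fin b) (p : Fin b × Bool) : Option Bool :=
  if p.1 = l then some p.2 else none

/-- Reassembles the choices of a row from its contribution to bucket `0` and, in case that it does
not fall into this bucket, its choices among the other buckets. -/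
def mergeSeed {b : ℕ} : Option Bool × (Fin b × Bool) → Fin (b + 1) × Bool
  | (none, p) => (p.1.succ, p.2)
  | (some s, _) => (0, s)

/-- `mergeSeed` turns independent choices into the choices of a row of a Count-Sketch with one more
bucket. -/
theorem sum_mergeSeed {b : ℕ} (hb : 0 < b) (G : Fin (b + 1) × Bool → ℝ) :
    ∑ p : Option Bool × (Fin b × Bool),
      (signWeight ((b : ℝ) + 1)⁻¹ p.1 * seedWeight b p.2) * G (mergeSeed p) =
      ∑ y, seedWeight (b + 1) y * G y := by
  have hb0 : (b : ℝ) ≠ 0 := by positivity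
  have hb1 : (b : ℝ) + 1 ≠ 0 := by positivity
  have e : ∀ a : Option Bool, ∑ p : Fin b × Bool,
      (signWeight ((b : ℝ) + 1)⁻¹ a * seedWeight b p) * G (mergeSeed (a, p)) =
      signWeight ((b : ℝ) + 1)⁻¹ a * ∑ p : Fin b × Bool, seedWeight b p * G (mergeSeed (a, p)) := by
    intro a
    rw [Finset.mul_sum]
    exact Finset.sum_congr rfl fun p _ => by ring
  rw [Fintype.sum_prod_type]
  simp only [e]
  rw [sum_signWeight]
  simp only [mergeSeed]
  rw [← Finset.sum_mul, ← Finset.sum_mul, sum_seedWeight hb, Fintype.sum_prod_type (α₁ := Fin (b + 1)),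
    Fin.sum_univ_succ, Fintype.sum_prod_type]
  simp only [Fintype.sum_bool, seedWeight, ← Finset.mul_sum]
  push_cast
  field_simp
  ring

theorem hit_zero_mergeSeed {b : ℕ} (a : Option Bool) (p : Fin b × Bool) :
    hit 0 (mergeSeed (a, p)) = a := by
  cases a <;> simp [hit, mergeSeed]

theorem hit_succ_mergeSeed {b : ℕ} (l : Fin b) (a : Option Bool) (p : Fin b × Bool) :
    signVal (hit l.succ (mergeSeed (a, p))) =
      signVal (hit l p) * (if a = none then 1 else 0) := by
  cases a
  · simp [hit, mergeSeed]
  · simp [hit, mergeSeed, Fin.succ_ne_zero, eq_comm]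

theorem Matrix.isSymm_sum {ι m : Type*} {s : Finset ι} {X : ι → Matrix m m ℝ}
    (h : ∀ i ∈ s, (X i).IsSymm) : (∑ i ∈ s, X i).IsSymm := by
  rw [Matrix.IsSymm, Matrix.transpose_sum]
  exact Finset.sum_congr rfl h

theorem sum_signWeight_hit {b : ℕ} (l : Fin b) (G : Option Bool → ℝ) :
    ∑ p, seedWeight b p * G (hit l p) = ∑ a, signWeight (b : ℝ)⁻¹ a * G a := by
  have hb0 : (b : ℝ) ≠ 0 := by
    have := l.pos
    positivity
  rw [sum_signWeight, Fintype.sum_prod_type]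
  simp only [Fintype.sum_bool, seedWeight, ← Finset.mul_sum]
  have e : ∀ k : Fin b, G (hit l (k, true)) + G (hit l (k, false)) =
      2 * G none + if k = l then G (some true) + G (some false) - 2 * G none else 0 := by
    intro k
    by_cases h : k = l
    · simp [hit, h]
    · simp [hit, h]; ring
  simp only [e, Finset.sum_add_distrib, Finset.sum_ite_eq', Finset.mem_univ, if_true,
    Finset.sum_const, Finset.card_univ, Fintype.card_fin, nsmul_eq_mul]
  field_simp
  ring

variable {Z : Matrix (Fin n) (Fin d) ℝ → Matrix (Fin d) (Fin d) ℝ}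

/-- The buckets are revealed one after the other. Given the rows in the earlier buckets, the rows
that fall into the next one are independent, and the rows already used can be replaced by zero. -/
theorem prodExp_trace_exp_buckets_le (hZ : ∀ V, (Z V).IsSymm) {a q₀ : ℝ} (ha : 0 ≤ a)
    (hbound : ∀ U, IsContraction U → ∀ q, 0 ≤ q → q ≤ q₀ → q ≤ 1 → ∀ x : Fin d → ℝ,
      prodExp (signWeight q) (fun ξ => x ⬝ᵥ exp (Z (signRows U ξ)) *ᵥ x) ≤ (1 + a) * (x ⬝ᵥ x))
    (L b : ℕ) (hLb : L < b) (hq : 1 ≤ q₀ * ((b : ℝ) - L + 1))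
    {U : Matrix (Fin n) (Fin d) ℝ} (hU : IsContraction U)
    {Y : Matrix (Fin d) (Fin d) ℝ} (hY : Y.IsSymm) :
    prodExp (seedWeight b) (fun c : Fin n → Fin b × Bool => (exp (Y + ∑ l : Fin b,
      if l.val < L then Z (signRows U fun j => hit l (c j)) else 0)).trace) ≤
      (1 + a) ^ L * (exp Y).trace := by
  induction L generalizing b U Y with
  | zero =>
    simp only [not_lt_zero, if_false, Finset.sum_const_zero, add_zero, pow_zero, one_mul]
    rw [prodExp_const (sum_seedWeight hLb)]
  | succ L ih =>
    obtain ⟨b, rfl⟩ : ∃ b', b = b' + 1 := ⟨b - 1, by omega⟩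
    have hb : 0 < b := by omega
    have hLb' : (L : ℝ) + 1 ≤ b := by exact_mod_cast (by omega : L + 1 ≤ b)
    push_cast at hq
    have hq0 : 0 < q₀ := by
      by_contra! h
      nlinarith
    have hq' : ((b : ℝ) + 1)⁻¹ ≤ q₀ := by
      rw [inv_le_iff_one_le_mul₀ (by positivity)]
      nlinarith
    have hq1 : ((b : ℝ) + 1)⁻¹ ≤ 1 := inv_le_one_of_one_le₀ (by linarith [Nat.cast_nonneg (α := ℝ) b])
    have hqn : 0 ≤ ((b : ℝ) + 1)⁻¹ := by positivity
    rw [← prodExp_comp _ _ mergeSeed (sum_mergeSeed hb), prodExp_prod]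
    have hinner : ∀ ξ : Fin n → Option Bool,
        prodExp (seedWeight b) (fun c : Fin n → Fin b × Bool => (exp (Y + ∑ l : Fin (b + 1),
          if l.val < L + 1 then
            Z (signRows U fun j => hit l (mergeSeed (ξ j, c j))) else 0)).trace) ≤
        (1 + a) ^ L * (exp (Y + Z (signRows U ξ))).trace := by
      intro ξ
      have hU' : IsContraction (rowScale (fun j => if ξ j = none then 1 else 0) U) :=
        hU.rowScale fun j => by split_ifs <;> norm_num
      refine le_trans (le_of_eq ?_) (ih b (by omega) (by linarith) hU' (hY.add (hZ (signRows U ξ))))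
      refine congrArg _ (funext fun c => ?_)
      rw [Fin.sum_univ_succ, ← add_assoc]
      simp only [Fin.val_zero, Nat.succ_pos, if_true, hit_zero_mergeSeed, Fin.val_succ,
        Nat.add_lt_add_iff_right]
      have e : ∀ l : Fin b, (signRows U fun j => hit l.succ (mergeSeed (ξ j, c j))) =
          signRows (rowScale (fun j => if ξ j = none then 1 else 0) U) fun j => hit l (c j) := by
        intro l
        ext j k
        simp only [signRows, rowScale, Matrix.of_apply, hit_succ_mergeSeed]
        ring
      simp only [e]
    refine (prodExp_mono (signWeight_nonneg hqn hq1) hinner).trans ?_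
    rw [prodExp_const_mul, pow_succ, mul_assoc]
    refine mul_le_mul_of_nonneg_left ?_ (by positivity)
    exact prodExp_trace_exp_add_le (signWeight_nonneg hqn hq1) (fun ξ => hZ _)
      (hbound U hU _ hqn hq' hq1) hY

/-- The same bound for the last buckets. -/
theorem prodExp_trace_exp_buckets_rev_le (hZ : ∀ V, (Z V).IsSymm) {a q₀ : ℝ} (ha : 0 ≤ a)
    (hbound : ∀ U, IsContraction U → ∀ q, 0 ≤ q → q ≤ q₀ → q ≤ 1 → ∀ x : Fin d → ℝ,
      prodExp (signWeight q) (fun ξ => x ⬝ᵥ exp (Z (signRows U ξ)) *ᵥ x) ≤ (1 + a) * (x ⬝ᵥ x))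
    (L b : ℕ) (hLb : L < b) (hq : 1 ≤ q₀ * ((b : ℝ) - L + 1))
    {U : Matrix (Fin n) (Fin d) ℝ} (hU : IsContraction U)
    {Y : Matrix (Fin d) (Fin d) ℝ} (hY : Y.IsSymm) :
    prodExp (seedWeight b) (fun c : Fin n → Fin b × Bool => (exp (Y + ∑ l : Fin b,
      if l.rev.val < L then Z (signRows U fun j => hit l (c j)) else 0)).trace) ≤
      (1 + a) ^ L * (exp Y).trace := by
  refine le_trans (le_of_eq ?_) (prodExp_trace_exp_buckets_le hZ ha hbound L b hLb hq hU hY)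
  rw [← prodExp_comp (seedWeight b) (seedWeight b) (fun p : Fin b × Bool => (p.1.rev, p.2))]
  · refine congrArg _ (funext fun c => ?_)
    rw [← Equiv.sum_comp Fin.revPerm]
    have e : ∀ l : Fin b, ∀ p : Fin b × Bool, hit l.rev (p.1.rev, p.2) = hit l p := by
      intro l p
      simp [hit]
    simp only [Fin.revPerm_apply, Fin.rev_rev, e]
  · intro G
    refine ((Fin.revPerm (n := b)).prodCongr (Equiv.refl Bool)).sum_comp
      (fun y => seedWeight b y * G y)

/-- Independent summands in the matrix Laplace transform method. -/
theorem prodExp_trace_exp_sum_le {κ : Type*} [Fintype κ] {w : κ → ℝ} (hw : ∀ c, 0 ≤ w c)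
    {A : ℝ} (hA : 0 ≤ A) {K : ℕ} (X : Fin K → κ → Matrix (Fin d) (Fin d) ℝ)
    (hX : ∀ i c, (X i c).IsSymm)
    (hstep : ∀ i, ∀ Y : Matrix (Fin d) (Fin d) ℝ, Y.IsSymm →
      ∑ c, w c * (exp (Y + X i c)).trace ≤ A * (exp Y).trace)
    {Y : Matrix (Fin d) (Fin d) ℝ} (hY : Y.IsSymm) :
    prodExp w (fun s => (exp (Y + ∑ i, X i (s i))).trace) ≤ A ^ K * (exp Y).trace := by
  induction K generalizing Y with
  | zero => simp [prodExp_zero]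
  | succ K ih =>
    rw [prodExp_succ]
    simp only [Fin.sum_univ_succ, Fin.cons_zero, Fin.cons_succ, ← add_assoc]
    have h := fun c => ih (fun i => X i.succ) (fun i => hX i.succ) (fun i => hstep i.succ)
      (hY.add (hX 0 c))
    refine (Finset.sum_le_sum fun c _ => mul_le_mul_of_nonneg_left (h c) (hw c)).trans ?_
    have e : ∀ c, w c * (A ^ K * (exp (Y + X 0 c)).trace) =
        A ^ K * (w c * (exp (Y + X 0 c)).trace) := fun c => by ring
    simp only [e]
    rw [← Finset.mul_sum, pow_succ, mul_assoc]
    exact mul_le_mul_of_nonneg_left (hstep 0 Y hY) (pow_nonneg hA K)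

end Reveal

/-! ### Tail bound for the surviving blocks -/

section Embedding

open NormedSpace

variable {n d b : ℕ}

/-- The uniform distribution on the choices behind one Count-Sketch. -/
noncomputable def countWeight (n b : ℕ) : CountSeed n b → ℝ := fun c => ∏ j, seedWeight b (c j)

theorem countWeight_nonneg (c : CountSeed n b) : 0 ≤ countWeight n b c :=
  Finset.prod_nonneg fun _ _ => seedWeight_nonneg b _

theorem sum_countWeight_mul (G : CountSeed n b → ℝ) :
    ∑ c, countWeight n b c * G c = prodExp (seedWeight b) G := rfl

theorem sum_countWeight (hb : 0 < b) : ∑ c, countWeight n b c = 1 := by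
  have := sum_countWeight_mul (n := n) (b := b) fun _ => 1
  rw [prodExp_const (sum_seedWeight hb)] at this
  simpa using this

/-- The rows of `U` that fall into bucket `l`, with their signs. -/
def bucketRows (U : Matrix (Fin n) (Fin d) ℝ) (c : CountSeed n b) (l : Fin b) :
    Matrix (Fin n) (Fin d) ℝ :=
  signRows U fun j => hit l (c j)

/-- The sum over the first half of the buckets. -/
def lowSum (Z : Matrix (Fin n) (Fin d) ℝ → Matrix (Fin d) (Fin d) ℝ)
    (U : Matrix (Fin n) (Fin d) ℝ) (c : CountSeed n b) : Matrix (Fin d) (Fin d) ℝ :=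
  ∑ l : Fin b, if l.val < (b + 1) / 2 then Z (bucketRows U c l) else 0

/-- The sum over the second half of the buckets. -/
def highSum (Z : Matrix (Fin n) (Fin d) ℝ → Matrix (Fin d) (Fin d) ℝ)
    (U : Matrix (Fin n) (Fin d) ℝ) (c : CountSeed n b) : Matrix (Fin d) (Fin d) ℝ :=
  ∑ l : Fin b, if l.rev.val < b / 2 then Z (bucketRows U c l) else 0

theorem lowSum_add_highSum (Z : Matrix (Fin n) (Fin d) ℝ → Matrix (Fin d) (Fin d) ℝ)
    (U : Matrix (Fin n) (Fin d) ℝ) (c : CountSeed n b) :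
    lowSum Z U c + highSum Z U c = ∑ l, Z (bucketRows U c l) := by
  rw [lowSum, highSum, ← Finset.sum_add_distrib]
  refine Finset.sum_congr rfl fun l _ => ?_
  have h : l.rev.val < b / 2 ↔ ¬ l.val < (b + 1) / 2 := by
    have := l.isLt
    rw [Fin.val_rev]
    omega
  by_cases h' : l.val < (b + 1) / 2
  · rw [if_pos h', if_neg fun t => h.1 t h', add_zero]
  · rw [if_neg h', if_pos (h.2 h'), zero_add]

variable {U : Matrix (Fin n) (Fin d) ℝ}

/-- Markov's inequality for the trace of the exponential of a sum of independent matrices. -/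
theorem prodExp_exists_lt_le {κ : Type*} [Fintype κ] {w : κ → ℝ} (hw : ∀ c, 0 ≤ w c)
    {A : ℝ} (hA : 1 ≤ A) {G : κ → Matrix (Fin d) (Fin d) ℝ} (hG : ∀ c, (G c).IsSymm)
    (hw1 : ∑ c, w c = 1)
    (hstep : ∀ Y : Matrix (Fin d) (Fin d) ℝ, Y.IsSymm →
      ∑ c, w c * (exp (Y + G c)).trace ≤ A * (exp Y).trace)
    {K : ℕ} (I : Finset (Fin K)) (t : ℝ) :
    prodExp w (fun s => open Classical in
      if ∃ x, t * (x ⬝ᵥ x) < x ⬝ᵥ (∑ i ∈ I, G (s i)) *ᵥ x then (1 : ℝ) else 0) ≤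
      Real.exp (-t) * (A ^ K * d) := by
  classical
  have hsum : ∀ s : Fin K → κ, ∑ i, (if i ∈ I then G (s i) else 0) = ∑ i ∈ I, G (s i) :=
    fun s => by simp
  have h := prodExp_trace_exp_sum_le hw (zero_le_one.trans hA)
    (fun (i : Fin K) c => if i ∈ I then G c else 0) ?_ ?_ (Matrix.isSymm_zero (n := Fin d) (α := ℝ))
  · simp only [zero_add, exp_zero, Matrix.trace_one, Fintype.card_fin, hsum] at h
    refine le_trans ?_ (mul_le_mul_of_nonneg_left h (Real.exp_pos (-t)).le)
    rw [← prodExp_const_mul]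
    refine prodExp_mono hw fun s => ?_
    have hs : (∑ i ∈ I, G (s i)).IsSymm := Matrix.isSymm_sum fun i _ => hG _
    split_ifs with hx
    · obtain ⟨x, hx⟩ := hx
      have := mul_le_mul_of_nonneg_left (exp_le_trace_exp hs hx) (Real.exp_pos (-t)).le
      rwa [← Real.exp_add, neg_add_cancel, Real.exp_zero] at this
    · exact mul_nonneg (Real.exp_pos _).le (trace_exp_nonneg hs)
  · intro i c
    split_ifs
    · exact hG c
    · exact Matrix.isSymm_zero
  · intro i Y hY
    split_ifs
    · exact hstep Y hY
    · rw [add_zero, ← Finset.sum_mul, hw1]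
      exact mul_le_mul_of_nonneg_right hA (trace_exp_nonneg hY)

/-- Each half of the buckets of a block. Revealing only half of them keeps the conditional
probability that a row falls into the next bucket below `2 / b`. -/
theorem sum_countWeight_trace_exp_le {Z : Matrix (Fin n) (Fin d) ℝ → Matrix (Fin d) (Fin d) ℝ}
    (hZ : ∀ V, (Z V).IsSymm) {a : ℝ} (ha : 0 ≤ a) (hb : 2 ≤ b)
    (hbound : ∀ U, IsContraction U → ∀ q, 0 ≤ q → q ≤ 2 / (b : ℝ) → q ≤ 1 → ∀ x : Fin d → ℝ,
      prodExp (signWeight q) (fun ξ => x ⬝ᵥ exp (Z (signRows U ξ)) *ᵥ x) ≤ (1 + a) * (x ⬝ᵥ x))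
    (hU : IsContraction U) {Y : Matrix (Fin d) (Fin d) ℝ} (hY : Y.IsSymm) :
    ∑ c, countWeight n b c * (exp (Y + lowSum Z U c)).trace ≤ (1 + a) ^ b * (exp Y).trace ∧
    ∑ c, countWeight n b c * (exp (Y + highSum Z U c)).trace ≤ (1 + a) ^ b * (exp Y).trace := by
  have hb0 : (0 : ℝ) < b := by positivity
  have hpow : ∀ L, L ≤ b → (1 + a) ^ L * (exp Y).trace ≤ (1 + a) ^ b * (exp Y).trace :=
    fun L hL => mul_le_mul_of_nonneg_right (pow_le_pow_right₀ (by linarith) hL)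
      (trace_exp_nonneg hY)
  have hq : ∀ L : ℕ, 2 * L ≤ b + 1 → 1 ≤ 2 / (b : ℝ) * ((b : ℝ) - L + 1) := by
    intro L hL
    have hL' : 2 * (L : ℝ) ≤ b + 1 := by exact_mod_cast hL
    rw [div_mul_eq_mul_div, le_div_iff₀ hb0]
    linarith
  constructor
  · rw [sum_countWeight_mul]
    exact (prodExp_trace_exp_buckets_le hZ ha hbound ((b + 1) / 2) b (by omega)
      (hq _ (by omega)) hU hY).trans (hpow _ (by omega))
  · rw [sum_countWeight_mul]
    exact (prodExp_trace_exp_buckets_rev_le hZ ha hbound (b / 2) b (by omega)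
      (hq _ (by omega)) hU hY).trans (hpow _ (by omega))

/-- Tail bound for the quadratic form of a sum of buckets over a set of blocks. -/
theorem prodExp_exists_buckets_lt_le {Z : Matrix (Fin n) (Fin d) ℝ → Matrix (Fin d) (Fin d) ℝ}
    (hZ : ∀ V, (Z V).IsSymm) {a : ℝ} (ha : 0 ≤ a) (hb : 2 ≤ b)
    (hbound : ∀ U, IsContraction U → ∀ q, 0 ≤ q → q ≤ 2 / (b : ℝ) → q ≤ 1 → ∀ x : Fin d → ℝ,
      prodExp (signWeight q) (fun ξ => x ⬝ᵥ exp (Z (signRows U ξ)) *ᵥ x) ≤ (1 + a) * (x ⬝ᵥ x))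
    (hU : IsContraction U) {K : ℕ} (I : Finset (Fin K)) (t : ℝ) :
    prodExp (countWeight n b) (fun s : SketchSeed n b K => open Classical in
      if ∃ x, 2 * t * (x ⬝ᵥ x) < x ⬝ᵥ (∑ i ∈ I, ∑ l, Z (bucketRows U (s i) l)) *ᵥ x
        then (1 : ℝ) else 0) ≤
      2 * (Real.exp (-t) * (((1 + a) ^ b) ^ K * d)) := by
  classical
  have hA : 1 ≤ (1 + a) ^ b := one_le_pow₀ (by linarith)
  have hsymm : ∀ (p : Fin b → Prop) [DecidablePred p] (c : CountSeed n b),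
      (∑ l : Fin b, if p l then Z (bucketRows U c l) else 0).IsSymm := fun p _ c =>
    Matrix.isSymm_sum fun l _ => by
      split_ifs
      · exact hZ _
      · exact Matrix.isSymm_zero
  have h1 := prodExp_exists_lt_le countWeight_nonneg hA (G := lowSum Z U)
    (fun c => hsymm (fun l => l.val < (b + 1) / 2) c) (sum_countWeight (by omega))
    (fun Y hY => (sum_countWeight_trace_exp_le hZ ha hb hbound hU hY).1) I t
  have h2 := prodExp_exists_lt_le countWeight_nonneg hA (G := highSum Z U)
    (fun c => hsymm (fun l => l.rev.val < b / 2) c) (sum_countWeight (by omega))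
    (fun Y hY => (sum_countWeight_trace_exp_le hZ ha hb hbound hU hY).2) I t
  rw [two_mul (Real.exp (-t) * (((1 + a) ^ b) ^ K * d))]
  refine le_trans ?_ (add_le_add h1 h2)
  rw [← prodExp_add]
  refine prodExp_mono countWeight_nonneg fun s => ?_
  by_cases hs : ∃ x, 2 * t * (x ⬝ᵥ x) < x ⬝ᵥ (∑ i ∈ I, ∑ l, Z (bucketRows U (s i) l)) *ᵥ x
  · rw [if_pos hs]
    obtain ⟨x, hx⟩ := hs
    simp only [← lowSum_add_highSum, Finset.sum_add_distrib, Matrix.add_mulVec,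
      dotProduct_add] at hx
    rcases lt_or_ge (t * (x ⬝ᵥ x)) (x ⬝ᵥ (∑ i ∈ I, lowSum Z U (s i)) *ᵥ x) with h | h
    · rw [if_pos ⟨x, h⟩]
      split_ifs <;> norm_num
    · have h' : t * (x ⬝ᵥ x) < x ⬝ᵥ (∑ i ∈ I, highSum Z U (s i)) *ᵥ x := by linarith
      rw [if_pos (⟨x, h'⟩ : ∃ x, t * (x ⬝ᵥ x) < x ⬝ᵥ (∑ i ∈ I, highSum Z U (s i)) *ᵥ x)]
      split_ifs <;> norm_num
  · rw [if_neg hs]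
    split_ifs <;> norm_num

/-- The probability that the buckets of the blocks in `I` distort some vector by more than `t`: the
first summand accounts for long buckets, the second one for the two tails of the two halves. -/
theorem prodExp_distortion_le (hU : IsContraction U) (hb : 2 ≤ b) {K : ℕ} (I : Finset (Fin K))
    {lam σ r : ℝ} (hlam : 0 < lam) (hσ : 0 ≤ σ) (hr : 1 ≤ r) (t : ℝ) {a : ℝ}
    (ha : lam * (2 * Real.exp (2 / (b : ℝ) * d * Real.exp σ - σ * r)) +
        lam ^ 2 * Real.exp (lam * r ^ 2) * (2 * (2 / (b : ℝ)) ^ 2 * d) ≤ a) :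
    prodExp (countWeight n b) (fun s : SketchSeed n b K => open Classical in
      if ∃ x, t * (x ⬝ᵥ x) <
          |x ⬝ᵥ (∑ i ∈ I, ∑ l, offDiagGram (bucketRows U (s i) l)) *ᵥ x|
        then (1 : ℝ) else 0) ≤
      K * b * (2 * Real.exp (2 / (b : ℝ) * d * Real.exp σ - σ * r)) +
      4 * (Real.exp (-(lam * t / 2)) * (((1 + a) ^ b) ^ K * d)) := by
  classical
  have hb0 : (0 : ℝ) < b := by positivity
  have hr0 : 0 ≤ r := zero_le_one.trans hr
  have ha0 : 0 ≤ a := le_trans (by positivity) ha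
  have hup := prodExp_exists_buckets_lt_le (isSymm_truncGram lam r) ha0 hb
    (fun U hU q h0 hq h1 x => (prodExp_exp_truncGram_le hU h0 hq h1 hlam.le hσ hr0 x).trans
      (mul_le_mul_of_nonneg_right (by linarith) (dotProduct_self_nonneg_real x))) hU I (lam * t / 2)
  have hlow := prodExp_exists_buckets_lt_le
    (Z := fun V : Matrix (Fin n) (Fin d) ℝ => (-lam) • offDiagGram V)
    (fun V => (isSymm_offDiagGram V).smul _) ha0 hb
    (fun U hU q h0 hq h1 x => (prodExp_exp_neg_offDiagGram_le hU h0 hq h1 hlam.le x).trans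
      (mul_le_mul_of_nonneg_right (by
        have h2 : Real.exp lam ≤ Real.exp (lam * r ^ 2) :=
          Real.exp_le_exp.2 (le_mul_of_one_le_right hlam.le (one_le_pow₀ hr))
        have h3 : lam ^ 2 * Real.exp lam * (2 * (2 / (b : ℝ)) ^ 2 * d) ≤
          lam ^ 2 * Real.exp (lam * r ^ 2) * (2 * (2 / (b : ℝ)) ^ 2 * d) := by gcongr
        have h4 : 0 ≤ lam * (2 * Real.exp (2 / (b : ℝ) * d * Real.exp σ - σ * r)) := by positivity
        linarith) (dotProduct_self_nonneg_real x))) hU I (lam * t / 2)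
  set J : Fin K → Fin b → SketchSeed n b K → ℝ := fun i l s =>
    if r ^ 2 < rowSum (bucketRows U (s i) l) ⬝ᵥ rowSum (bucketRows U (s i) l) then 1 else 0 with hJ
  have hJ0 : ∀ i l s, 0 ≤ J i l s := fun i l s => by
    simp only [hJ]
    split_ifs <;> norm_num
  have hlong : prodExp (countWeight n b) (fun s => ∑ i, ∑ l, J i l s) ≤
      K * b * (2 * Real.exp (2 / (b : ℝ) * d * Real.exp σ - σ * r)) := by
    rw [prodExp_sum]
    have hone : ∀ i l, prodExp (countWeight n b) (J i l) ≤
        2 * Real.exp (2 / (b : ℝ) * d * Real.exp σ - σ * r) := by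
      intro i l
      rw [hJ, prodExp_coord (sum_countWeight (by omega)) i (fun c : CountSeed n b =>
        if r ^ 2 < rowSum (bucketRows U c l) ⬝ᵥ rowSum (bucketRows U c l) then (1 : ℝ) else 0),
        sum_countWeight_mul]
      have hb1 : (b : ℝ)⁻¹ ≤ 1 := inv_le_one_of_one_le₀ (by exact_mod_cast (by omega : 1 ≤ b))
      have hbi : (b : ℝ)⁻¹ ≤ 2 / (b : ℝ) := by
        rw [inv_eq_one_div]; gcongr; norm_num
      have h := prodExp_rowSum_gt_le hU (inv_nonneg.2 hb0.le) hb1 hσ hr0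
      rw [← prodExp_comp (seedWeight b) _ (hit l) (sum_signWeight_hit l)] at h
      refine h.trans ?_
      gcongr
    calc _ ≤ ∑ _i : Fin K, ∑ _l : Fin b,
          2 * Real.exp (2 / (b : ℝ) * d * Real.exp σ - σ * r) := by
          refine Finset.sum_le_sum fun i _ => ?_
          rw [prodExp_sum]
          exact Finset.sum_le_sum fun l _ => hone i l
      _ = _ := by simp [mul_assoc]
  have h4 : ∀ X : ℝ, 4 * X = 2 * X + 2 * X := fun X => by ring
  rw [h4]
  refine le_trans ?_ (add_le_add hlong (add_le_add hup hlow))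
  rw [← prodExp_add, ← prodExp_add]
  refine prodExp_mono countWeight_nonneg fun s => ?_
  have hsum0 : 0 ≤ ∑ i, ∑ l, J i l s :=
    Finset.sum_nonneg fun i _ => Finset.sum_nonneg fun l _ => hJ0 i l s
  have hind : ∀ p : Prop, 0 ≤ (if p then (1 : ℝ) else 0) := fun p => by split_ifs <;> norm_num
  by_cases hbad : ∃ x, t * (x ⬝ᵥ x) <
      |x ⬝ᵥ (∑ i ∈ I, ∑ l, offDiagGram (bucketRows U (s i) l)) *ᵥ x|
  swap
  · rw [if_neg hbad]
    exact add_nonneg hsum0 (add_nonneg (hind _) (hind _))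
  rw [if_pos hbad]
  obtain ⟨x, hx⟩ := hbad
  have e2 : 2 * (lam * t / 2) * (x ⬝ᵥ x) = lam * (t * (x ⬝ᵥ x)) := by ring
  rcases lt_abs.1 hx with h | h
  · by_cases hex : ∃ i l, r ^ 2 < rowSum (bucketRows U (s i) l) ⬝ᵥ rowSum (bucketRows U (s i) l)
    · obtain ⟨i, l, hil⟩ := hex
      have h1 : (1 : ℝ) ≤ ∑ i, ∑ l, J i l s := by
        calc (1 : ℝ) = J i l s := by simp only [hJ]; rw [if_pos hil]
          _ ≤ ∑ l, J i l s := Finset.single_le_sum (f := fun l => J i l s)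
            (fun l _ => hJ0 i l s) (Finset.mem_univ l)
          _ ≤ _ := Finset.single_le_sum (f := fun i => ∑ l, J i l s)
            (fun i _ => Finset.sum_nonneg fun l _ => hJ0 i l s) (Finset.mem_univ i)
      linarith [add_nonneg (hind (∃ x, 2 * (lam * t / 2) * (x ⬝ᵥ x) <
        x ⬝ᵥ (∑ i ∈ I, ∑ l, truncGram lam r (bucketRows U (s i) l)) *ᵥ x))
        (hind (∃ x, 2 * (lam * t / 2) * (x ⬝ᵥ x) <
        x ⬝ᵥ (∑ i ∈ I, ∑ l, (-lam) • offDiagGram (bucketRows U (s i) l)) *ᵥ x))]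
    · have htr : ∀ i l, truncGram lam r (bucketRows U (s i) l) =
          lam • offDiagGram (bucketRows U (s i) l) := fun i l => by
        rw [truncGram, if_neg fun h => hex ⟨i, l, h⟩]
      have hy : ∃ x, 2 * (lam * t / 2) * (x ⬝ᵥ x) <
          x ⬝ᵥ (∑ i ∈ I, ∑ l, truncGram lam r (bucketRows U (s i) l)) *ᵥ x := by
        refine ⟨x, ?_⟩
        simp only [htr, ← Finset.smul_sum]
        rw [Matrix.smul_mulVec, dotProduct_smul, smul_eq_mul, e2]
        exact mul_lt_mul_of_pos_left h hlam
      rw [if_pos hy]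
      linarith [hind (∃ x, 2 * (lam * t / 2) * (x ⬝ᵥ x) <
        x ⬝ᵥ (∑ i ∈ I, ∑ l, (-lam) • offDiagGram (bucketRows U (s i) l)) *ᵥ x)]
  · have hy : ∃ x, 2 * (lam * t / 2) * (x ⬝ᵥ x) <
        x ⬝ᵥ (∑ i ∈ I, ∑ l, (-lam) • offDiagGram (bucketRows U (s i) l)) *ᵥ x := by
      refine ⟨x, ?_⟩
      simp only [← Finset.smul_sum]
      rw [Matrix.smul_mulVec, dotProduct_smul, smul_eq_mul, e2, neg_mul, ← mul_neg]
      exact mul_lt_mul_of_pos_left h hlam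
    rw [if_pos hy]
    linarith [hind (∃ x, 2 * (lam * t / 2) * (x ⬝ᵥ x) <
        x ⬝ᵥ (∑ i ∈ I, ∑ l, truncGram lam r (bucketRows U (s i) l)) *ᵥ x)]

end Embedding

/-! ### The distortion of the surviving sketch -/

section Identity

variable {n d b N e : ℕ}

theorem countSketch_apply (c : CountSeed n b) (j : Fin n) (l : Fin b) :
    countSketch c j l = signVal (hit l (c j)) := by
  rcases h : c j with ⟨k, s⟩
  by_cases hk : k = l
  · cases s <;> simp [countSketch, hit, h, hk]
  · simp [countSketch, hit, h, hk]

theorem sum_hit_sq (p : Fin b × Bool) : ∑ l, signVal (hit l p) ^ 2 = 1 := by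
  have : ∀ l, signVal (hit l p) ^ 2 = if p.1 = l then 1 else 0 := by
    intro l
    rcases p with ⟨k, s⟩
    by_cases hk : k = l
    · cases s <;> simp [hit, hk]
    · simp [hit, hk]
  simp [this]

theorem dotProduct_transpose_mul_self {m k : Type*} [Fintype m] [Fintype k]
    (M : Matrix m k ℝ) (x : k → ℝ) : x ⬝ᵥ (Mᵀ * M) *ᵥ x = (M *ᵥ x) ⬝ᵥ (M *ᵥ x) := by
  rw [← Matrix.mulVec_mulVec, Matrix.dotProduct_mulVec, Matrix.vecMul_transpose]

theorem sketchedHessian_eq {κ : Type} [Fintype κ] (U : Matrix (Fin n) (Fin d) ℝ)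
    (S : Matrix (Fin n) κ ℝ) : sketchedHessian U S = (Sᵀ * U)ᵀ * (Sᵀ * U) := by
  simp [sketchedHessian, Matrix.mul_assoc]

/-- The distortion of the sketch is the sum of the off-diagonal parts of the buckets, because every
row falls into exactly one bucket of each block. -/
theorem dotProduct_sketchedHessian_sub (hN : 0 < N) (U : Matrix (Fin n) (Fin d) ℝ)
    (s : SketchSeed n b (N + e)) {r : Fin N → Fin (N + e)} (hr : Function.Injective r)
    (x : Fin d → ℝ) :
    (N : ℝ) * (x ⬝ᵥ sketchedHessian U (survivingSketch s r) *ᵥ x - (U *ᵥ x) ⬝ᵥ (U *ᵥ x)) =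
      x ⬝ᵥ (∑ i ∈ Finset.univ.image r, ∑ l, offDiagGram (bucketRows U (s i) l)) *ᵥ x := by
  classical
  have hN0 : (0 : ℝ) < N := by exact_mod_cast hN
  have e1 : x ⬝ᵥ sketchedHessian U (survivingSketch s r) *ᵥ x =
      (N : ℝ)⁻¹ * ∑ k : Fin N, ∑ l : Fin b, (rowSum (bucketRows U (s (r k)) l) ⬝ᵥ x) ^ 2 := by
    rw [sketchedHessian_eq, dotProduct_transpose_mul_self, ← Matrix.mulVec_mulVec, dotProduct,
      Fintype.sum_prod_type, Finset.mul_sum]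
    refine Finset.sum_congr rfl fun k _ => ?_
    rw [Finset.mul_sum]
    refine Finset.sum_congr rfl fun l _ => ?_
    have : ((survivingSketch s r)ᵀ *ᵥ (U *ᵥ x)) (k, l) =
        1 / Real.sqrt N * (rowSum (bucketRows U (s (r k)) l) ⬝ᵥ x) := by
      rw [bucketRows, rowSum_signRows_dotProduct, Finset.mul_sum, Matrix.mulVec, dotProduct]
      refine Finset.sum_congr rfl fun j _ => ?_
      simp only [survivingSketch, overSketch, Matrix.transpose_apply, Matrix.submatrix_apply, id,
        Prod.map, Matrix.of_apply, countSketch_apply]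
      ring
    rw [this]
    have hs : Real.sqrt N * Real.sqrt N = N := Real.mul_self_sqrt hN0.le
    calc _ = (Real.sqrt N * Real.sqrt N)⁻¹ * (rowSum (bucketRows U (s (r k)) l) ⬝ᵥ x) ^ 2 := by
          ring
      _ = _ := by rw [hs]
  have e2 : ∀ c : CountSeed n b, ∑ l, (bucketRows U c l *ᵥ x) ⬝ᵥ (bucketRows U c l *ᵥ x) =
      (U *ᵥ x) ⬝ᵥ (U *ᵥ x) := by
    intro c
    simp only [dotProduct]
    rw [Finset.sum_comm]
    refine Finset.sum_congr rfl fun j _ => ?_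
    have : ∀ l, (bucketRows U c l *ᵥ x) j * (bucketRows U c l *ᵥ x) j =
        signVal (hit l (c j)) ^ 2 * ((U *ᵥ x) j * (U *ᵥ x) j) := by
      intro l
      rw [bucketRows, signRows, rowScale_mulVec]
      ring
    simp only [this]
    rw [← Finset.sum_mul, sum_hit_sq, one_mul]
  rw [Finset.sum_image (fun a _ b _ h => hr h)]
  simp only [Matrix.sum_mulVec, dotProduct_sum, dotProduct_offDiagGram, Finset.sum_sub_distrib, e2]
  rw [e1, mul_sub, ← mul_assoc, mul_inv_cancel₀ hN0.ne', one_mul]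
  simp

end Identity

/-! ### The choice of the parameters -/

section Parameters

open Real

/-- The numerical core of the choice of parameters: `D` is the dimension, `K` the number of blocks,
`2 * D / ρ` the number of buckets of a block, `r = √R` the length up to which a bucket counts as
short, `p` the probability of a long bucket, `1 + a` the exponential moment of one bucket at
`λ = μ log D / (2 R)`, and `t` the product of the accuracy and the number of survivors. -/
theorem failure_bound {μ τ D K ρ θ R r t : ℝ} (hμ : 0 < μ) (hτ : 0 < τ) (hD : 2 ≤ D)
    (hK : 0 ≤ K) (hρ : 0 < ρ) (hρD : ρ ≤ D ^ (-μ)) (hKρ : K * ρ ≤ θ * D ^ (-μ))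
    (hR : 1 ≤ R) (hr : r = 2 + (τ + 1) / μ) (hθ1 : θ ≤ 1 / 48)
    (hθ2 : 12 * θ * μ ≤ R * τ) (ht : 4 * R * (τ + 7) / μ ≤ t) {p a : ℝ}
    (hp : p = 2 * exp (1 + log ρ * r))
    (ha : a = μ * log D / (2 * R) * p +
      (μ * log D / (2 * R)) ^ 2 * exp (μ * log D / 2) * (2 * (ρ / D) ^ 2 * D)) :
    K * (2 * D / ρ) * p + 4 * (exp (-(μ * log D / (2 * R) * t / 2)) *
      (exp (a * (2 * D / ρ * K)) * D)) ≤ D ^ (-τ) / 2 := by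
  have hD0 : 0 < D := by linarith
  have hR0 : 0 < R := by linarith
  have hℓ : 0 < log D := log_pos (by linarith)
  have hθ0 : 0 ≤ θ := by
    have h1 : 0 < D ^ (-μ) := rpow_pos_of_pos hD0 _
    by_contra! h
    nlinarith [mul_nonneg hK hρ.le, mul_neg_of_neg_of_pos h h1]
  have hexp1 : exp 1 ≤ 3 := by linarith [exp_one_lt_d9]
  have hDτ : 0 < D ^ (-τ) := rpow_pos_of_pos hD0 _
  have hDμ : 0 < D ^ (-μ) := rpow_pos_of_pos hD0 _
  -- the probability that a fixed bucket is long
  have hpb : p ≤ 6 * (ρ ^ 2 * (D ^ (-τ) * D⁻¹)) := by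
    have h1 : exp (log ρ * r) = ρ ^ 2 * ρ ^ ((τ + 1) / μ) := by
      rw [← rpow_def_of_pos hρ, hr, rpow_add hρ, rpow_two]
    have h2 : ρ ^ ((τ + 1) / μ) ≤ D ^ (-τ) * D⁻¹ := by
      calc ρ ^ ((τ + 1) / μ) ≤ (D ^ (-μ)) ^ ((τ + 1) / μ) :=
            rpow_le_rpow hρ.le hρD (by positivity)
        _ = D ^ (-τ) * D⁻¹ := by
            rw [← rpow_mul hD0.le, ← rpow_neg_one, ← rpow_add hD0]
            congr 1
            field_simp
            ring
    rw [hp, exp_add, h1]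
    have h3 := mul_le_mul_of_nonneg_left h2 (sq_nonneg ρ)
    have h4 : 0 ≤ ρ ^ 2 * ρ ^ ((τ + 1) / μ) := by positivity
    nlinarith [mul_le_mul_of_nonneg_right hexp1 h4]
  have hp0 : 0 ≤ p := by rw [hp]; positivity
  have hT1 : K * (2 * D / ρ) * p ≤ 12 * θ * D ^ (-τ) := by
    calc K * (2 * D / ρ) * p ≤ K * (2 * D / ρ) * (6 * (ρ ^ 2 * (D ^ (-τ) * D⁻¹))) := by gcongr
      _ = 12 * (K * ρ) * D ^ (-τ) := by field_simp; ring
      _ ≤ 12 * (θ * 1) * D ^ (-τ) := by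
          have : D ^ (-μ) ≤ 1 := rpow_le_one_of_one_le_of_nonpos (by linarith) (by linarith)
          have : K * ρ ≤ θ * 1 := hKρ.trans (mul_le_mul_of_nonneg_left this hθ0)
          gcongr
      _ = _ := by ring
  -- the accumulated exponential moments of all buckets are bounded by a constant
  have hlogτ : log D * D ^ (-τ) ≤ 1 / τ := by
    have h1 := log_le_rpow_div hD0.le hτ
    have h2 : D ^ τ * D ^ (-τ) = 1 := by rw [← rpow_add hD0]; simp
    calc log D * D ^ (-τ) ≤ D ^ τ / τ * D ^ (-τ) := by gcongr
      _ = (D ^ τ * D ^ (-τ)) / τ := by ring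
      _ = _ := by rw [h2]
  have hA1 : μ * log D / (2 * R) * (K * (2 * D / ρ) * p) ≤ 1 / 2 := by
    calc μ * log D / (2 * R) * (K * (2 * D / ρ) * p)
        ≤ μ * log D / (2 * R) * (12 * θ * D ^ (-τ)) := by gcongr
      _ = 6 * θ * μ / R * (log D * D ^ (-τ)) := by field_simp; ring
      _ ≤ 6 * θ * μ / R * (1 / τ) := by gcongr
      _ ≤ 1 / 2 := by
          rw [div_mul_div_comm, div_le_div_iff₀ (by positivity) (by norm_num)]
          linarith
  have hlogμ : (μ * log D) ^ 2 * D ^ (-(μ / 2)) ≤ 16 := by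
    have h1 : μ * log D ≤ 4 * D ^ (μ / 4) := by
      have := log_le_rpow_div hD0.le (show 0 < μ / 4 by positivity)
      rw [le_div_iff₀ (by positivity)] at this
      linarith
    have h2 : (D ^ (μ / 4)) ^ 2 * D ^ (-(μ / 2)) = 1 := by
      rw [← rpow_natCast, ← rpow_mul hD0.le, ← rpow_add hD0]
      norm_num
      rw [show μ / 4 * 2 + -(μ / 2) = 0 by ring, rpow_zero]
    calc (μ * log D) ^ 2 * D ^ (-(μ / 2)) ≤ (4 * D ^ (μ / 4)) ^ 2 * D ^ (-(μ / 2)) := by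
          gcongr
      _ = 16 * ((D ^ (μ / 4)) ^ 2 * D ^ (-(μ / 2))) := by ring
      _ = 16 := by rw [h2, mul_one]
  have hA2 : (μ * log D / (2 * R)) ^ 2 * exp (μ * log D / 2) * (2 * (ρ / D) ^ 2 * D) *
      (2 * D / ρ * K) ≤ 1 / 2 := by
    have h1 : exp (μ * log D / 2) = D ^ (μ / 2) := by
      rw [rpow_def_of_pos hD0]; congr 1; ring
    have h2 : D ^ (μ / 2) * D ^ (-μ) = D ^ (-(μ / 2)) := by
      rw [← rpow_add hD0]; congr 1; ring
    calc _ = (μ * log D) ^ 2 / R ^ 2 * D ^ (μ / 2) * (K * ρ) := by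
          rw [h1]; field_simp
      _ ≤ (μ * log D) ^ 2 / R ^ 2 * D ^ (μ / 2) * (θ * D ^ (-μ)) := by gcongr
      _ = θ / R ^ 2 * ((μ * log D) ^ 2 * D ^ (-(μ / 2))) := by rw [← h2]; ring
      _ ≤ θ / R ^ 2 * 16 := by gcongr
      _ ≤ θ / 1 * 16 := by gcongr; nlinarith
      _ ≤ 1 / 2 := by linarith
  have hA : exp (a * (2 * D / ρ * K)) ≤ 3 := by
    refine le_trans (exp_le_exp.2 ?_) hexp1
    rw [ha, add_mul]
    calc _ = μ * log D / (2 * R) * (K * (2 * D / ρ) * p) + (μ * log D / (2 * R)) ^ 2 *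
          exp (μ * log D / 2) * (2 * (ρ / D) ^ 2 * D) * (2 * D / ρ * K) := by ring
      _ ≤ 1 := by linarith
  -- the Laplace transform beats the dimension
  have hL : exp (-(μ * log D / (2 * R) * t / 2)) ≤ D ^ (-τ) * (1 / 2) ^ 6 * D⁻¹ := by
    have h1 : (τ + 7) * log D ≤ μ * log D / (2 * R) * t / 2 := by
      have h2 : τ + 7 ≤ μ / (4 * R) * t := by
        rw [div_le_iff₀ hμ] at ht
        rw [div_mul_eq_mul_div, le_div_iff₀ (by positivity)]
        linarith
      have := mul_le_mul_of_nonneg_right h2 hℓ.le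
      calc _ ≤ μ / (4 * R) * t * log D := this
        _ = _ := by field_simp; ring
    calc exp (-(μ * log D / (2 * R) * t / 2)) ≤ exp (log D * (-τ + -6 + -1)) :=
          exp_le_exp.2 (by linarith)
      _ = D ^ (-τ) * (D ^ 6)⁻¹ * D⁻¹ := by
          rw [← rpow_def_of_pos hD0, rpow_add hD0, rpow_add hD0, rpow_neg_one,
            rpow_neg hD0.le 6]
          norm_num
      _ ≤ D ^ (-τ) * (1 / 2) ^ 6 * D⁻¹ := by
          have : (D ^ 6)⁻¹ ≤ (1 / 2 : ℝ) ^ 6 := by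
            rw [one_div, inv_pow]
            gcongr
          gcongr
  have hT2 : 4 * (exp (-(μ * log D / (2 * R) * t / 2)) *
      (exp (a * (2 * D / ρ * K)) * D)) ≤ D ^ (-τ) / 4 := by
    calc _ ≤ 4 * ((D ^ (-τ) * (1 / 2) ^ 6 * D⁻¹) * (3 * D)) := by gcongr
      _ = 12 / 64 * D ^ (-τ) := by field_simp; norm_num
      _ ≤ _ := by linarith
  nlinarith

end Parameters

/-! ### The subspace embedding property -/

section EmbeddingProperty

/-- The failure probability of the embedding for admissible constants: `r²` bounds the squared
length of a bucket, `κ / ε` is the required number of surviving blocks. -/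
theorem embedding_failure_le {μ τ ζ κ κ₂ C ρ₀ : ℝ} (hμ : 0 < μ) (hτ : 0 < τ) (hζ : 0 < ζ)
    (hρ₀ : ρ₀ = 2 + (τ + 1) / μ) (hκ : κ = 4 * ρ₀ ^ 2 * (τ + 7) / μ) (hκ₂0 : 0 < κ₂)
    (hC1 : 2 * κ₂ ≤ C) (hC2 : 96 * κ₂ ^ 2 ≤ C) (hC3 : 24 * κ₂ ^ 2 * μ / (ρ₀ ^ 2 * τ) ≤ C)
    {d n N e b : ℕ} {ε : ℝ} {U : Matrix (Fin n) (Fin d) ℝ} {r : Fin N → Fin (N + e)}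
    (hd : 2 ≤ d) (hε : 0 < ε) (hε1 : ε ≤ 1) (he : (e : ℝ) ≤ ζ * (N : ℝ))
    (hK1 : (1 + ζ) * κ / ε ≤ (N : ℝ) + (e : ℝ)) (hK2 : (N : ℝ) + (e : ℝ) ≤ κ₂ / ε)
    (hm : C * ((d : ℝ) ^ (1 + μ) / ε ^ 2) ≤ (N : ℝ) * (b : ℝ) + (e : ℝ) * (b : ℝ))
    (hU : IsContraction U) (hr : Function.Injective r) :
    prodExp (countWeight n b) (fun s : SketchSeed n b (N + e) => open Classical in
      if ∃ x, ε * (x ⬝ᵥ x) < |x ⬝ᵥ sketchedHessian U (survivingSketch s r) *ᵥ x -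
        (U *ᵥ x) ⬝ᵥ (U *ᵥ x)| then (1 : ℝ) else 0) ≤ (d : ℝ) ^ (-τ) / 2 := by
  classical
  have hρ₀1 : 1 ≤ ρ₀ := by
    have : 0 < (τ + 1) / μ := by positivity
    linarith
  set R : ℝ := ρ₀ ^ 2 with hRdef
  have hR : 1 ≤ R := one_le_pow₀ hρ₀1
  have hR0 : 0 < R := by linarith
  have hκ0 : 0 < κ := by rw [hκ]; positivity
  have hC0 : 0 < C := by linarith
  have hD : (2 : ℝ) ≤ d := by exact_mod_cast hd
  have hD0 : (0 : ℝ) < d := by linarith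
  set K : ℝ := (N : ℝ) + e with hKdef
  have hK0 : 0 < K := lt_of_lt_of_le (by positivity) hK1
  have hNpos : (0 : ℝ) < N := by
    by_contra! h
    have : ζ * (N : ℝ) ≤ 0 := mul_nonpos_of_nonneg_of_nonpos hζ.le h
    linarith
  have hKε : K * ε ≤ κ₂ := (le_div_iff₀ hε).1 hK2
  have hpow : (d : ℝ) ^ (1 + μ) = d * (d : ℝ) ^ μ := by rw [Real.rpow_add hD0, Real.rpow_one]
  have hdμ : 0 < (d : ℝ) ^ μ := Real.rpow_pos_of_pos hD0 _
  have hdμ1 : 1 ≤ (d : ℝ) ^ μ := Real.one_le_rpow (by linarith) hμ.le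
  have hKb : C * (d * (d : ℝ) ^ μ) ≤ K * b * ε ^ 2 := by
    rw [hpow, ← add_mul, ← mul_div_assoc, div_le_iff₀ (by positivity)] at hm
    exact hm
  have hb0 : (0 : ℝ) < b := by
    have h1 : 0 < C * (d * (d : ℝ) ^ μ) := by positivity
    by_contra! h
    have : K * b * ε ^ 2 ≤ 0 :=
      mul_nonpos_of_nonpos_of_nonneg (mul_nonpos_of_nonneg_of_nonpos hK0.le h) (sq_nonneg ε)
    linarith
  set ρ : ℝ := 2 * d / b with hρ
  have hρ0 : 0 < ρ := by positivity
  -- `b ≥ C d^{1+μ} / (ε κ₂)`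
  have hbε : C * (d * (d : ℝ) ^ μ) ≤ κ₂ * ε * b := by
    calc _ ≤ K * b * ε ^ 2 := hKb
      _ = (K * ε) * (ε * b) := by ring
      _ ≤ κ₂ * (ε * b) := by gcongr
      _ = _ := by ring
  have hρD : ρ ≤ (d : ℝ) ^ (-μ) := by
    rw [Real.rpow_neg hD0.le, ← one_div, hρ, div_le_div_iff₀ hb0 hdμ]
    have h1 : 2 * κ₂ * (d * (d : ℝ) ^ μ) ≤ κ₂ * ε * b := by
      refine le_trans ?_ hbε
      gcongr
    have h2 : κ₂ * (2 * d * (d : ℝ) ^ μ) ≤ κ₂ * (1 * b) := by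
      have : κ₂ * ε * b ≤ κ₂ * 1 * b := by gcongr
      linarith
    exact le_of_mul_le_mul_left h2 hκ₂0
  set θ : ℝ := 2 * κ₂ ^ 2 / C with hθ
  have hKρ : K * ρ ≤ θ * (d : ℝ) ^ (-μ) := by
    rw [Real.rpow_neg hD0.le, ← div_eq_mul_inv, hθ, div_div, hρ, ← mul_div_assoc,
      div_le_div_iff₀ hb0 (by positivity)]
    calc K * (2 * d) * (C * (d : ℝ) ^ μ) = 2 * K * (C * (d * (d : ℝ) ^ μ)) := by ring
      _ ≤ 2 * K * (κ₂ * ε * b) := by gcongr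
      _ = 2 * (K * ε) * κ₂ * b := by ring
      _ ≤ 2 * κ₂ * κ₂ * b := by gcongr
      _ = _ := by ring
  have hθ1 : θ ≤ 1 / 48 := by
    rw [hθ, div_le_div_iff₀ hC0 (by norm_num)]
    linarith
  have hθ2 : 12 * θ * μ ≤ R * τ := by
    have h1 := hC3
    rw [div_le_iff₀ (by positivity)] at h1
    rw [hθ, show 12 * (2 * κ₂ ^ 2 / C) * μ = 24 * κ₂ ^ 2 * μ / C by ring, div_le_iff₀ hC0]
    linarith
  have ht : κ ≤ ε * N := by
    have h1 : (1 + ζ) * κ ≤ (1 + ζ) * (ε * N) := by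
      rw [div_le_iff₀ hε] at hK1
      have : K ≤ (1 + ζ) * N := by rw [hKdef]; linarith
      calc _ ≤ K * ε := hK1
        _ ≤ (1 + ζ) * N * ε := by gcongr
        _ = _ := by ring
    exact le_of_mul_le_mul_left h1 (by positivity)
  have hb2 : 2 ≤ b := by
    have h1 : ρ ≤ 1 :=
      hρD.trans (Real.rpow_le_one_of_one_le_of_nonpos (by linarith) (by linarith))
    rw [hρ, div_le_one hb0] at h1
    exact_mod_cast (by linarith : (2 : ℝ) ≤ b)
  set p : ℝ := 2 * Real.exp (1 + Real.log ρ * ρ₀) with hp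
  set lam : ℝ := μ * Real.log d / (2 * R) with hlamdef
  set a : ℝ := lam * p + lam ^ 2 * Real.exp (μ * Real.log d / 2) * (2 * (ρ / d) ^ 2 * d) with ha
  have hfin := failure_bound hμ hτ hD hK0.le hρ0 hρD hKρ hR hρ₀ hθ1 hθ2 (hκ ▸ ht) hp ha
  have hlog : 0 < Real.log d := Real.log_pos (by linarith)
  have hlam : 0 < lam := by positivity
  have ha0 : 0 ≤ a := by positivity
  have hσ : 0 ≤ -Real.log ρ := by
    have h1 : ρ ≤ 1 :=
      hρD.trans (Real.rpow_le_one_of_one_le_of_nonpos (by linarith) (by linarith))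
    have := Real.log_nonpos hρ0.le h1
    linarith
  have hpe : 2 * Real.exp (2 / (b : ℝ) * d * Real.exp (-Real.log ρ) - -Real.log ρ * ρ₀) = p := by
    have e0 : 2 / (b : ℝ) * d * ρ⁻¹ = 1 := by rw [hρ]; field_simp
    rw [hp, Real.exp_neg, Real.exp_log hρ0, e0, neg_mul, sub_neg_eq_add]
  have hI := prodExp_distortion_le hU hb2 (Finset.univ.image r) hlam hσ hρ₀1 (ε * N) (a := a) (by
    rw [hpe, ha]
    have e1 : lam * ρ₀ ^ 2 = μ * Real.log d / 2 := by
      rw [hlamdef, ← hRdef]; field_simp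
    have e2 : ρ / d = 2 / b := by rw [hρ]; field_simp
    rw [e1, e2])
  rw [hpe] at hI
  refine le_trans ?_ (hI.trans (le_trans (add_le_add ?_ ?_) hfin))
  · refine le_of_eq (congrArg _ (funext fun s => ?_))
    refine if_congr (exists_congr fun x => ?_) rfl rfl
    rw [← dotProduct_sketchedHessian_sub (by exact_mod_cast hNpos) U s hr x, abs_mul,
      abs_of_pos hNpos, mul_right_comm, mul_comm (N : ℝ) |_|]
    exact (mul_lt_mul_iff_left₀ hNpos).symm
  · refine le_of_eq ?_
    have : 2 * (d : ℝ) / ρ = b := by rw [hρ]; field_simp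
    rw [this, hKdef]
    push_cast
    rfl
  · refine mul_le_mul_of_nonneg_left ?_ (by norm_num)
    refine mul_le_mul_of_nonneg_left ?_ (Real.exp_pos _).le
    refine mul_le_mul_of_nonneg_right ?_ hD0.le
    have e1 : 2 * (d : ℝ) / ρ = b := by rw [hρ]; field_simp
    have e2 : a * (2 * d / ρ * K) = ((b * (N + e) : ℕ) : ℝ) * a := by
      rw [e1, hKdef]; push_cast; ring
    rw [← pow_mul, e2, Real.exp_nat_mul]
    refine pow_le_pow_left₀ (by linarith) ?_ _
    linarith [Real.add_one_le_exp a]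

/-- **OverSketch is an oblivious subspace embedding.** For every matrix `U` that does not increase
norms, the sketch of `UᵀU` is accurate up to `ε` with high probability, whatever the fixed set of
surviving blocks. -/
theorem exists_embedding_constants {μ τ ζ : ℝ} (hμ : 0 < μ) (hτ : 0 < τ) (hζ : 0 < ζ) :
    ∃ κ₁ : ℝ, 0 < κ₁ ∧ ∀ κ₂ : ℝ, κ₁ ≤ κ₂ → ∃ C : ℝ, 0 < C ∧
      ∀ (d n N e b : ℕ) (ε : ℝ) (U : Matrix (Fin n) (Fin d) ℝ) (r : Fin N → Fin (N + e)),
        2 ≤ d → 0 < ε → ε ≤ 1 → (e : ℝ) ≤ ζ * (N : ℝ) →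
        κ₁ / ε ≤ (N : ℝ) + (e : ℝ) → (N : ℝ) + (e : ℝ) ≤ κ₂ / ε →
        C * ((d : ℝ) ^ (1 + μ) / ε ^ 2) ≤ (N : ℝ) * (b : ℝ) + (e : ℝ) * (b : ℝ) →
        IsContraction U → Function.Injective r →
        prodExp (countWeight n b) (fun s : SketchSeed n b (N + e) => open Classical in
          if ∃ x, ε * (x ⬝ᵥ x) < |x ⬝ᵥ sketchedHessian U (survivingSketch s r) *ᵥ x -
            (U *ᵥ x) ⬝ᵥ (U *ᵥ x)| then (1 : ℝ) else 0) ≤ (d : ℝ) ^ (-τ) / 2 := by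
  have hρ₀ : 0 < 2 + (τ + 1) / μ := by positivity
  refine ⟨(1 + ζ) * (4 * (2 + (τ + 1) / μ) ^ 2 * (τ + 7) / μ), by positivity, fun κ₂ hκ₂ => ?_⟩
  have hκ₂0 : 0 < κ₂ := lt_of_lt_of_le (by positivity) hκ₂
  have h1 : 0 < 2 * κ₂ := by positivity
  have h2 : 0 < 96 * κ₂ ^ 2 := by positivity
  have h3 : 0 < 24 * κ₂ ^ 2 * μ / ((2 + (τ + 1) / μ) ^ 2 * τ) := by positivity
  refine ⟨2 * κ₂ + 96 * κ₂ ^ 2 + 24 * κ₂ ^ 2 * μ / ((2 + (τ + 1) / μ) ^ 2 * τ), by linarith, ?_⟩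
  intro d n N e b ε U r hd hε hε1 he hK1 hK2 hm hU hr
  exact embedding_failure_le hμ hτ hζ rfl rfl hκ₂0 (by linarith) (by linarith) (by linarith)
    hd hε hε1 he hK1 hK2 hm hU hr

/-- A matrix with trivial kernel becomes an isometry after an invertible change of variables. -/
theorem exists_whitening {n d : ℕ} {A : Matrix (Fin n) (Fin d) ℝ}
    (hA : ∀ x, x ≠ 0 → 0 < (A *ᵥ x) ⬝ᵥ (A *ᵥ x)) :
    ∃ B B' : Matrix (Fin d) (Fin d) ℝ, B * B' = 1 ∧ (A * B)ᵀ * (A * B) = 1 := by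
  have hsymm : (Aᵀ * A).IsSymm := by simp [Matrix.IsSymm]
  obtain ⟨O, v, h1, h2, h3, -⟩ := exists_orthogonal_diagonalization hsymm
  have hv : ∀ i, 0 < v i := by
    intro i
    have e1 : Oᵀ *ᵥ (O *ᵥ Pi.single i (1 : ℝ)) = Pi.single i 1 := by
      rw [Matrix.mulVec_mulVec, h2, Matrix.one_mulVec]
    have hne : O *ᵥ Pi.single i (1 : ℝ) ≠ 0 := by
      intro h
      rw [h, Matrix.mulVec_zero] at e1
      have := congrFun e1 i
      simp at this
    have := hA _ hne
    rw [← dotProduct_transpose_mul_self, h3, dotProduct_diagonalization, e1] at this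
    simpa [Pi.single_apply] using this
  have hs : ∀ i, Real.sqrt (v i) ≠ 0 := fun i => (Real.sqrt_pos.2 (hv i)).ne'
  refine ⟨O * Matrix.diagonal (fun i => (Real.sqrt (v i))⁻¹),
    Matrix.diagonal (fun i => Real.sqrt (v i)) * Oᵀ, ?_, ?_⟩
  · rw [mul_assoc, ← mul_assoc (Matrix.diagonal _) (Matrix.diagonal _),
      Matrix.diagonal_mul_diagonal]
    simp only [inv_mul_cancel₀ (hs _), Matrix.diagonal_one, one_mul, h1]
  · have e : (A * (O * Matrix.diagonal (fun i => (Real.sqrt (v i))⁻¹)))ᵀ *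
        (A * (O * Matrix.diagonal (fun i => (Real.sqrt (v i))⁻¹))) =
        Matrix.diagonal (fun i => (Real.sqrt (v i))⁻¹) * (Oᵀ * (Aᵀ * A) * O) *
          Matrix.diagonal (fun i => (Real.sqrt (v i))⁻¹) := by
      simp only [Matrix.transpose_mul, Matrix.diagonal_transpose, Matrix.mul_assoc]
    rw [e, h3]
    have e2 : Oᵀ * (O * Matrix.diagonal v * Oᵀ) * O = Matrix.diagonal v := by
      calc _ = (Oᵀ * O) * Matrix.diagonal v * (Oᵀ * O) := by simp only [Matrix.mul_assoc]
        _ = _ := by rw [h2, one_mul, mul_one]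
    rw [e2, Matrix.diagonal_mul_diagonal, Matrix.diagonal_mul_diagonal]
    have e3 : ∀ i, (Real.sqrt (v i))⁻¹ * v i * (Real.sqrt (v i))⁻¹ = 1 := by
      intro i
      have := Real.mul_self_sqrt (hv i).le
      have h0 := hs i
      field_simp
      rw [pow_two, this]
    simp only [e3, Matrix.diagonal_one]

/-- The sketch `S` preserves all squared norms `‖A x‖²` up to a relative error `ε`. -/
def IsAccurate {n d : ℕ} {κ : Type} [Fintype κ] (ε : ℝ) (A : Matrix (Fin n) (Fin d) ℝ)
    (S : Matrix (Fin n) κ ℝ) : Prop :=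
  ∀ x : Fin d → ℝ, |x ⬝ᵥ sketchedHessian A S *ᵥ x - (A *ᵥ x) ⬝ᵥ (A *ᵥ x)| ≤
    ε * ((A *ᵥ x) ⬝ᵥ (A *ᵥ x))

/-- Accuracy is invariant under changes of variables, so it is enough to sketch `A B`, whose columns
are orthonormal. -/
theorem isAccurate_of_whitening {n d : ℕ} {κ : Type} [Fintype κ] {ε : ℝ}
    {A : Matrix (Fin n) (Fin d) ℝ} {B B' : Matrix (Fin d) (Fin d) ℝ} (hB : B * B' = 1)
    (hAB : (A * B)ᵀ * (A * B) = 1) {S : Matrix (Fin n) κ ℝ}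
    (h : ∀ x, |x ⬝ᵥ sketchedHessian (A * B) S *ᵥ x - ((A * B) *ᵥ x) ⬝ᵥ ((A * B) *ᵥ x)| ≤
      ε * (x ⬝ᵥ x)) : IsAccurate ε A S := by
  intro x
  have hy := h (B' *ᵥ x)
  have e1 : (A * B) *ᵥ (B' *ᵥ x) = A *ᵥ x := by
    rw [Matrix.mulVec_mulVec, Matrix.mul_assoc, hB, Matrix.mul_one]
  have e2 : (B' *ᵥ x) ⬝ᵥ (B' *ᵥ x) = (A *ᵥ x) ⬝ᵥ (A *ᵥ x) := by
    rw [← e1, ← dotProduct_transpose_mul_self (A * B), hAB, Matrix.one_mulVec]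
  rw [e2, e1, sketchedHessian_eq, dotProduct_transpose_mul_self, ← Matrix.mulVec_mulVec, e1] at hy
  rwa [sketchedHessian_eq, dotProduct_transpose_mul_self, ← Matrix.mulVec_mulVec]

theorem uniformOn_univ_eq_prodExp {n b K : ℕ} (hb : 0 < b) (p : SketchSeed n b K → Prop) :
    uniformOn (Set.univ : Set (SketchSeed n b K)) {s | p s} =
      ENNReal.ofReal (prodExp (countWeight n b) fun s => open Classical in
        if p s then (1 : ℝ) else 0) := by
  classical
  have hw : ∀ s : SketchSeed n b K, ∏ i, countWeight n b (s i) =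
      ((Fintype.card (SketchSeed n b K) : ℝ))⁻¹ := by
    intro s
    simp [countWeight, seedWeight, mul_comm]
    rw [← mul_inv, inv_pow, inv_pow]
  have hcard : (Fintype.card (SketchSeed n b K) : ℝ) ≠ 0 := by
    simp
    intro h
    omega
  rw [uniformOn_univ, Measure.count_apply (Set.toFinite _).measurableSet]
  simp only [prodExp, hw]
  rw [← Finset.mul_sum, Finset.sum_boole, Set.encard_eq_coe_toFinset_card,
    ENNReal.ofReal_mul (by positivity), ENNReal.ofReal_inv_of_pos (by positivity),
    ENNReal.ofReal_natCast, ENNReal.ofReal_natCast, ENNReal.div_eq_inv_mul]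
  simp

end EmbeddingProperty

/-! ### One approximate Newton step -/

section Newton

variable {E : Type*} [NormedAddCommGroup E] [InnerProductSpace ℝ E]

/-- A symmetric operator is bounded by its quadratic form. -/
theorem norm_apply_le_of_abs_inner_le {B : E →L[ℝ] E} {c : ℝ} (hc : 0 ≤ c)
    (hB : ∀ x y, inner ℝ (B x) y = inner ℝ x (B y))
    (h : ∀ x, |inner ℝ x (B x)| ≤ c * ‖x‖ ^ 2) (x : E) : ‖B x‖ ≤ c * ‖x‖ := by
  rcases eq_or_ne (B x) 0 with h0 | h0
  · rw [h0, norm_zero]; positivity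
  have hpos : 0 < ‖B x‖ := norm_pos_iff.2 h0
  set y : E := (‖x‖ / ‖B x‖) • B x with hy
  have hyn : ‖y‖ = ‖x‖ := by
    rw [hy, norm_smul, Real.norm_of_nonneg (by positivity), div_mul_cancel₀ _ hpos.ne']
  have h1 := (abs_le.1 (h (x + y))).2
  have h2 := (abs_le.1 (h (x - y))).1
  have e1 : inner ℝ (x + y) (B (x + y)) - inner ℝ (x - y) (B (x - y)) = 4 * inner ℝ y (B x) := by
    simp only [map_add, map_sub, inner_add_left, inner_add_right, inner_sub_left, inner_sub_right]
    rw [← hB x y, real_inner_comm y (B x)]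
    ring
  have e2 := parallelogram_law_with_norm ℝ x y
  have e3 : inner ℝ y (B x) = ‖x‖ * ‖B x‖ := by
    rw [hy, real_inner_smul_left, real_inner_self_eq_norm_sq]
    field_simp
  have h3 : ‖x‖ * ‖B x‖ ≤ c * ‖x‖ * ‖x‖ := by
    rw [hyn] at e2
    nlinarith
  rcases eq_or_lt_of_le (norm_nonneg x) with hx | hx
  · have : x = 0 := norm_eq_zero.1 hx.symm
    rw [this, map_zero, norm_zero, mul_zero]
  · nlinarith

/-- The error after one Newton step with a spectral approximation `T` of the Hessian `H`, in terms
of the previous error `δ` and the gradient `g`. -/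
theorem norm_newton_step_le {H T : E →L[ℝ] E} {γ β ε L : ℝ} {δ δ' g : E} (hγ : 0 < γ)
    (hε0 : 0 < ε) (hε : ε ≤ 1 / 8) (hβ : 0 < β)
    (hHs : ∀ x y, inner ℝ (H x) y = inner ℝ x (H y))
    (hTs : ∀ x y, inner ℝ (T x) y = inner ℝ x (T y))
    (hH1 : ∀ x, 7 / 8 * γ * ‖x‖ ^ 2 ≤ inner ℝ x (H x))
    (hH2 : ∀ x, inner ℝ x (H x) ≤ 9 / 8 * β * ‖x‖ ^ 2)
    (hT : ∀ x, |inner ℝ x (T x) - inner ℝ x (H x)| ≤ ε * inner ℝ x (H x))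
    (hg : ‖H δ - g‖ ≤ L * ‖δ‖ ^ 2) (hδ' : T δ' = T δ - g) :
    49 / 64 * γ * ‖δ'‖ ≤ ε * (9 / 8 * β) * ‖δ‖ + L * ‖δ‖ ^ 2 := by
  have hB : ‖(T - H) δ‖ ≤ ε * (9 / 8 * β) * ‖δ‖ := by
    refine norm_apply_le_of_abs_inner_le (by positivity) (fun x y => ?_) (fun x => ?_) δ
    · simp only [sub_apply, inner_sub_left, inner_sub_right, hHs, hTs]
    · rw [sub_apply, inner_sub_right, mul_assoc]
      exact (hT x).trans (mul_le_mul_of_nonneg_left (hH2 x) hε0.le)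
  have hlow : 49 / 64 * γ * ‖δ'‖ ≤ ‖T δ'‖ := by
    rcases eq_or_lt_of_le (norm_nonneg δ') with h0 | h0
    · rw [← h0, mul_zero]; exact norm_nonneg _
    have h1 := (abs_le.1 (hT δ')).1
    have h2 : 49 / 64 * γ * ‖δ'‖ ^ 2 ≤ inner ℝ δ' (T δ') := by
      have h3 := hH1 δ'
      have h4 : 0 ≤ inner ℝ δ' (H δ') := le_trans (by positivity) h3
      nlinarith
    have h3 := real_inner_le_norm δ' (T δ')
    nlinarith
  have hup : ‖T δ'‖ ≤ ε * (9 / 8 * β) * ‖δ‖ + L * ‖δ‖ ^ 2 := by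
    have e : T δ' = (T - H) δ + (H δ - g) := by
      rw [hδ', sub_apply]; abel
    rw [e]
    exact (norm_add_le _ _).trans (add_le_add hB hg)
  exact hlow.trans hup

variable {d : ℕ}

theorem inner_toEuclideanCLM (M : Matrix (Fin d) (Fin d) ℝ) (x y : Vec d) :
    inner ℝ x (Matrix.toEuclideanCLM (𝕜 := ℝ) M y) = x.ofLp ⬝ᵥ M *ᵥ y.ofLp := by
  rw [EuclideanSpace.inner_eq_star_dotProduct]
  simp [dotProduct_comm]

theorem inner_toEuclideanCLM_comm {M : Matrix (Fin d) (Fin d) ℝ} (hM : M.IsSymm) (x y : Vec d) :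
    inner ℝ (Matrix.toEuclideanCLM (𝕜 := ℝ) M x) y =
      inner ℝ x (Matrix.toEuclideanCLM (𝕜 := ℝ) M y) := by
  rw [real_inner_comm, inner_toEuclideanCLM, inner_toEuclideanCLM, Matrix.dotProduct_mulVec,
    ← Matrix.mulVec_transpose, hM.eq, dotProduct_comm]

/-- The extreme eigenvalues bound the quadratic form of a symmetric matrix. -/
theorem inner_toEuclideanCLM_bounds {M : Matrix (Fin d) (Fin d) ℝ} (hM : M.IsSymm) {γ β : ℝ}
    (hγ : ∀ a, Module.End.HasEigenvalue
      (Matrix.toEuclideanCLM (𝕜 := ℝ) M : Vec d →ₗ[ℝ] Vec d) a → γ ≤ a)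
    (hβ : ∀ a, Module.End.HasEigenvalue
      (Matrix.toEuclideanCLM (𝕜 := ℝ) M : Vec d →ₗ[ℝ] Vec d) a → a ≤ β) (x : Vec d) :
    γ * ‖x‖ ^ 2 ≤ inner ℝ x (Matrix.toEuclideanCLM (𝕜 := ℝ) M x) ∧
      inner ℝ x (Matrix.toEuclideanCLM (𝕜 := ℝ) M x) ≤ β * ‖x‖ ^ 2 := by
  obtain ⟨O, v, h1, h2, h3, -⟩ := exists_orthogonal_diagonalization hM
  have hev : ∀ i, Module.End.HasEigenvalue
      (Matrix.toEuclideanCLM (𝕜 := ℝ) M : Vec d →ₗ[ℝ] Vec d) (v i) := by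
    intro i
    have e1 : Oᵀ *ᵥ (O *ᵥ Pi.single i (1 : ℝ)) = Pi.single i 1 := by
      rw [Matrix.mulVec_mulVec, h2, Matrix.one_mulVec]
    refine Module.End.hasEigenvalue_of_hasEigenvector
      (x := WithLp.toLp 2 (O *ᵥ Pi.single i (1 : ℝ))) ⟨?_, ?_⟩
    · rw [Module.End.mem_eigenspace_iff]
      apply (WithLp.ofLp_injective 2)
      simp only [ContinuousLinearMap.coe_coe, Matrix.ofLp_toEuclideanCLM, WithLp.ofLp_smul]
      rw [h3, ← Matrix.mulVec_mulVec, ← Matrix.mulVec_mulVec, e1, ← Matrix.mulVec_smul]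
      congr 1
      ext k
      rw [Matrix.mulVec_diagonal]
      by_cases hk : k = i
      · subst hk; simp
      · simp [hk]
    · intro h
      have h' : O *ᵥ Pi.single i (1 : ℝ) = 0 := congrArg WithLp.ofLp h
      rw [h', Matrix.mulVec_zero] at e1
      have := congrFun e1 i
      simp at this
  have hone : ‖x‖ ^ 2 = ∑ i, 1 * (Oᵀ *ᵥ x.ofLp) i ^ 2 := by
    rw [← dotProduct_diagonalization O (fun _ => 1) x.ofLp, Matrix.diagonal_one, mul_one, h1,
      Matrix.one_mulVec, EuclideanSpace.norm_sq_eq]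
    simp [dotProduct, pow_two]
  rw [inner_toEuclideanCLM, hone]
  conv => rw [h3]
  rw [dotProduct_diagonalization, Finset.mul_sum, Finset.mul_sum]
  constructor
  · refine Finset.sum_le_sum fun i _ => ?_
    rw [one_mul]
    exact mul_le_mul_of_nonneg_right (hγ _ (hev i)) (sq_nonneg _)
  · refine Finset.sum_le_sum fun i _ => ?_
    rw [one_mul]
    exact mul_le_mul_of_nonneg_right (hβ _ (hev i)) (sq_nonneg _)

theorem gradient_eq_zero_of_forall_le {f : Vec d → ℝ} {w : Vec d} (h : ∀ z, f w ≤ f z) :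
    gradient f w = 0 := by
  have : fderiv ℝ f w = 0 := IsLocalMin.fderiv_eq_zero (Filter.Eventually.of_forall h)
  rw [gradient, this, map_zero]

/-- First-order Taylor expansion of the gradient at `w`, evaluated at the minimizer. -/
theorem norm_hessian_apply_sub_gradient_le {f : Vec d → ℝ} (hf : TwiceDifferentiable f) {L : ℝ}
    (hL0 : 0 < L) (hL : HessianLipschitz L f) {w₁ : Vec d} (h : ∀ z, f w₁ ≤ f z) (w : Vec d) :
    ‖hessian f w (w - w₁) - gradient f w‖ ≤ L * ‖w - w₁‖ ^ 2 := by
  have hlip : ∀ z, ‖hessian f z - hessian f w‖ ≤ L * ‖z - w‖ := by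
    intro z
    have := hL w (z - w)
    rwa [add_sub_cancel] at this
  have hm := (convex_closedBall w ‖w - w₁‖).norm_image_sub_le_of_norm_hasFDerivWithin_le'
    (f := gradient f) (f' := hessian f) (φ := hessian f w) (C := L * ‖w - w₁‖) (x := w) (y := w₁)
    (fun z _ => (hf.2 z).hasFDerivAt.hasFDerivWithinAt)
    (fun z hz => (hlip z).trans (mul_le_mul_of_nonneg_left (mem_closedBall_iff_norm.1 hz) hL0.le))
    (Metric.mem_closedBall_self (norm_nonneg _))
    (by rw [mem_closedBall_iff_norm, norm_sub_rev])
  rw [gradient_eq_zero_of_forall_le h] at hm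
  have e : (0 : Vec d) - gradient f w - hessian f w (w₁ - w) =
      hessian f w (w - w₁) - gradient f w := by
    rw [← neg_sub w w₁, map_neg]; abel
  rw [e, norm_sub_rev w₁ w] at hm
  linarith

end Newton

section Step

variable {n d : ℕ}

theorem isSymm_sketchedHessian {κ : Type} [Fintype κ] (A : Matrix (Fin n) (Fin d) ℝ)
    (S : Matrix (Fin n) κ ℝ) : (sketchedHessian A S).IsSymm := by
  rw [sketchedHessian_eq]
  simp [Matrix.IsSymm]

theorem inner_hessian_eq {f : Vec d → ℝ} {A : Vec d → Matrix (Fin n) (Fin d) ℝ}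
    (hA : IsHessianSqrt f A) (w x : Vec d) :
    inner ℝ x (hessian f w x) = (A w *ᵥ x.ofLp) ⬝ᵥ (A w *ᵥ x.ofLp) := by
  rw [← hA w, inner_toEuclideanCLM, dotProduct_transpose_mul_self]

/-- One step of OverSketched Newton from a point near the minimizer, with an accurate sketch. -/
theorem newton_step {f : Vec d → ℝ} {A : Vec d → Matrix (Fin n) (Fin d) ℝ} {L γ β ε : ℝ}
    {wstar : Vec d} (hf : TwiceDifferentiable f) (hL0 : 0 < L) (hL : HessianLipschitz L f)
    (hA : IsHessianSqrt f A) (hmin : ∀ w, f wstar ≤ f w)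
    (hγ : IsLeast {a : ℝ | IsHessianEigenvalue f wstar a} γ)
    (hβ : IsGreatest {a : ℝ | IsHessianEigenvalue f wstar a} β) (hγ0 : 0 < γ)
    (hε0 : 0 < ε) (hε : ε ≤ γ / (8 * β)) {w : Vec d} (hw : ‖w - wstar‖ ≤ γ / (8 * L))
    {κ : Type} [Fintype κ] {S : Matrix (Fin n) κ ℝ} (hS : IsAccurate ε (A w) S) {w' : Vec d}
    (hw' : w' = w - Matrix.toEuclideanCLM (𝕜 := ℝ) (sketchedHessian (A w) S)⁻¹ (gradient f w)) :
    IsUnit (sketchedHessian (A w) S).det ∧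
      ‖w' - wstar‖ ≤ 25 * L / (8 * γ) * ‖w - wstar‖ ^ 2 + 5 * ε * β / γ * ‖w - wstar‖ ∧
      ‖w' - wstar‖ ≤ γ / (8 * L) := by
  have hγβ : γ ≤ β := hγ.2 hβ.1
  have hβ0 : 0 < β := hγ0.trans_le hγβ
  have hεβ : ε * β ≤ γ / 8 := by
    rw [le_div_iff₀ (by positivity)] at hε
    linarith
  have hε8 : ε ≤ 1 / 8 := by
    refine le_of_mul_le_mul_right ?_ hβ0
    linarith
  set M := sketchedHessian (A w) S with hM
  set H := hessian f w with hH
  set T : Vec d →L[ℝ] Vec d := Matrix.toEuclideanCLM (𝕜 := ℝ) M with hTdef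
  have hTs : ∀ x y, inner ℝ (T x) y = inner ℝ x (T y) :=
    inner_toEuclideanCLM_comm (isSymm_sketchedHessian _ _)
  have hHs : ∀ x y, inner ℝ (H x) y = inner ℝ x (H y) := by
    rw [hH, ← hA w]
    exact inner_toEuclideanCLM_comm (by simp [Matrix.IsSymm])
  have hTq : ∀ x, |inner ℝ x (T x) - inner ℝ x (H x)| ≤ ε * inner ℝ x (H x) := by
    intro x
    rw [hTdef, inner_toEuclideanCLM, hH, inner_hessian_eq hA]
    exact hS x.ofLp
  have hstar := fun x => inner_toEuclideanCLM_bounds (M := (A wstar)ᵀ * A wstar)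
    (by simp [Matrix.IsSymm]) (γ := γ) (β := β)
    (fun a ha => hγ.2 (show IsHessianEigenvalue f wstar a by
      rw [IsHessianEigenvalue, ← hA wstar]; exact ha))
    (fun a ha => hβ.2 (show IsHessianEigenvalue f wstar a by
      rw [IsHessianEigenvalue, ← hA wstar]; exact ha)) x
  rw [hA wstar] at hstar
  have hdiff : ∀ x, |inner ℝ x (H x) - inner ℝ x (hessian f wstar x)| ≤ γ / 8 * ‖x‖ ^ 2 := by
    intro x
    rw [← inner_sub_right, ← sub_apply]
    have h1 : ‖H - hessian f wstar‖ ≤ γ / 8 := by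
      have := hL wstar (w - wstar)
      rw [add_sub_cancel] at this
      refine this.trans ?_
      rw [le_div_iff₀ (by positivity)] at hw
      linarith
    calc |inner ℝ x ((H - hessian f wstar) x)| ≤ ‖x‖ * ‖(H - hessian f wstar) x‖ :=
          abs_real_inner_le_norm _ _
      _ ≤ ‖x‖ * (γ / 8 * ‖x‖) := by
          gcongr
          exact ContinuousLinearMap.le_of_opNorm_le _ h1 x
      _ = _ := by ring
  have hH1 : ∀ x, 7 / 8 * γ * ‖x‖ ^ 2 ≤ inner ℝ x (H x) := by
    intro x
    have h1 := (abs_le.1 (hdiff x)).1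
    have h2 := (hstar x).1
    linarith
  have hH2 : ∀ x, inner ℝ x (H x) ≤ 9 / 8 * β * ‖x‖ ^ 2 := by
    intro x
    have h1 := (abs_le.1 (hdiff x)).2
    have h2 := (hstar x).2
    have h3 : γ / 8 * ‖x‖ ^ 2 ≤ β / 8 * ‖x‖ ^ 2 := by gcongr
    linarith
  have hunit : IsUnit M.det := by
    rw [← Matrix.isUnit_iff_isUnit_det, ← Matrix.mulVec_injective_iff_isUnit]
    refine (injective_iff_map_eq_zero M.mulVecLin).2 fun y hy => ?_
    have hy' : M *ᵥ y = 0 := hy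
    have h1 := (abs_le.1 (hTq (WithLp.toLp 2 y))).1
    rw [hTdef, inner_toEuclideanCLM, hy', dotProduct_zero] at h1
    have h2 := hH1 (WithLp.toLp 2 y)
    have h3 : ‖(WithLp.toLp 2 y : Vec d)‖ = 0 := by
      by_contra hne
      have h4 : 0 < 7 / 8 * γ * ‖(WithLp.toLp 2 y : Vec d)‖ ^ 2 := by positivity
      nlinarith
    have h5 := norm_eq_zero.1 h3
    exact congrArg WithLp.ofLp h5
  have hstep : T (w' - wstar) = T (w - wstar) - gradient f w := by
    have h1 : T (Matrix.toEuclideanCLM (𝕜 := ℝ) M⁻¹ (gradient f w)) = gradient f w := by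
      rw [hTdef, ← mul_apply_eq_comp, ← map_mul, Matrix.mul_nonsing_inv _ hunit,
        map_one, one_apply_eq_self]
    rw [hw', sub_right_comm, map_sub T (w - wstar), h1]
  have key := norm_newton_step_le hγ0 hε0 hε8 hβ0 hHs hTs hH1 hH2 hTq
    (norm_hessian_apply_sub_gradient_le hf hL0 hL hmin w) hstep
  refine ⟨hunit, ?_, ?_⟩
  · have e : 25 * L / (8 * γ) * ‖w - wstar‖ ^ 2 + 5 * ε * β / γ * ‖w - wstar‖ =
        (25 / 8 * L * ‖w - wstar‖ ^ 2 + 5 * ε * β * ‖w - wstar‖) / γ := by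
      field_simp
    rw [e, le_div_iff₀ hγ0]
    have p1 : 0 ≤ L * ‖w - wstar‖ ^ 2 := by positivity
    have p2 : 0 ≤ ε * β * ‖w - wstar‖ := by positivity
    nlinarith
  · refine le_trans ?_ hw
    refine le_of_mul_le_mul_left ?_ (show 0 < 49 / 64 * γ by positivity)
    have h0 := norm_nonneg (w - wstar)
    have h1 : L * ‖w - wstar‖ ≤ γ / 8 := by
      rw [le_div_iff₀ (by positivity)] at hw
      linarith
    have h2 := mul_le_mul_of_nonneg_right h1 h0
    have h3 := mul_le_mul_of_nonneg_right hεβ h0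
    nlinarith [mul_nonneg hγ0.le h0]

end Step

/-! ### The random iteration -/

section Iterates

variable {n d b N e : ℕ}

/-- The iterate at time `t` depends only on the earlier sketches. -/
theorem osnIterate_congr {κ : Type} [Fintype κ] (f : Vec d → ℝ)
    (A : Vec d → Matrix (Fin n) (Fin d) ℝ) (w₀ : Vec d) {S S' : ℕ → Matrix (Fin n) κ ℝ} {t : ℕ}
    (h : ∀ s < t, S s = S' s) : osnIterate f A w₀ S t = osnIterate f A w₀ S' t := by
  induction t with
  | zero => rfl
  | succ t ih =>
    rw [osnIterate, osnIterate, ih fun s hs => h s (hs.trans t.lt_succ_self), h t t.lt_succ_self]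

/-- A sketch that is accurate with high probability for every fixed matrix and every fixed set of
survivors is accurate for the random current iterate, since the latter is independent of the
current seed. -/
theorem measure_not_isAccurate_le {Ω : Type*} [MeasurableSpace Ω] (P : Measure Ω)
    [IsProbabilityMeasure P] {seed : ℕ → Ω → SketchSeed n b (N + e)}
    {ret : ℕ → Ω → Fin N → Fin (N + e)} (hproc : IsOverSketchProcess P seed ret)
    (f : Vec d → ℝ) (A : Vec d → Matrix (Fin n) (Fin d) ℝ) (w₀ : Vec d) {ε : ℝ} {δ : ENNReal}
    (hδ : ∀ (w : Vec d) (r : Fin N → Fin (N + e)), Function.Injective r →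
      uniformOn (Set.univ : Set (SketchSeed n b (N + e)))
        {s | ¬ IsAccurate ε (A w) (survivingSketch s r)} ≤ δ) (t : ℕ) :
    P {ω | ¬ IsAccurate ε (A (osnIterate f A w₀
      (fun s => survivingSketch (seed s ω) (ret s ω)) t))
      (survivingSketch (seed t ω) (ret t ω))} ≤ δ := by
  let Past := (Fin N → Fin (N + e)) × (Fin t → SketchSeed n b (N + e) × (Fin N → Fin (N + e)))
  let past : Ω → Past := fun ω => (ret t ω, fun s : Fin t => (seed s ω, ret s ω))
  -- the current iterate as a function of the earlier randomness; the value `0` is never used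
  let W : Past → Vec d := fun p => osnIterate f A w₀ (fun s =>
    if h : s < t then survivingSketch (p.2 ⟨s, h⟩).1 (p.2 ⟨s, h⟩).2 else 0) t
  have hpast : Measurable past := (hproc.measurable_ret t).prodMk
    (measurable_pi_lambda _ fun s => (hproc.measurable_seed s).prodMk (hproc.measurable_ret s))
  have hW : ∀ ω, osnIterate f A w₀ (fun s => survivingSketch (seed s ω) (ret s ω)) t =
      W (past ω) := fun ω => osnIterate_congr f A w₀ fun s hs => by simp [past, hs]
  let B : Set (SketchSeed n b (N + e) × Past) :=
    {z | Function.Injective z.2.1 ∧ ¬ IsAccurate ε (A (W z.2)) (survivingSketch z.1 z.2.1)}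
  have hB : MeasurableSet B := (Set.toFinite B).measurableSet
  have hmap := (indepFun_iff_map_prod_eq_prod_map_map (hproc.measurable_seed t).aemeasurable
    hpast.aemeasurable).1 (hproc.indep t)
  have hprob : IsProbabilityMeasure (P.map (seed t)) :=
    Measure.isProbabilityMeasure_map (hproc.measurable_seed t).aemeasurable
  have hprob' : IsProbabilityMeasure (P.map past) :=
    Measure.isProbabilityMeasure_map hpast.aemeasurable
  calc P {ω | ¬ IsAccurate ε (A (osnIterate f A w₀
        (fun s => survivingSketch (seed s ω) (ret s ω)) t))
        (survivingSketch (seed t ω) (ret t ω))}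
      = P ((fun ω => (seed t ω, past ω)) ⁻¹' B) := by
        refine congrArg P (Set.ext fun ω => ?_)
        simp only [Set.mem_ofPred_eq, Set.mem_preimage, B, ← hW]
        exact ⟨fun h => ⟨hproc.injective_ret t ω, h⟩, fun h => h.2⟩
    _ = ((P.map (seed t)).prod (P.map past)) B := by
        rw [← Measure.map_apply ((hproc.measurable_seed t).prodMk hpast) hB, hmap]
    _ = ∫⁻ p, P.map (seed t) ((fun s => (s, p)) ⁻¹' B) ∂(P.map past) :=
        Measure.prod_apply_symm hB
    _ ≤ ∫⁻ _, δ ∂(P.map past) := by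
        refine lintegral_mono fun p => ?_
        rw [hproc.law_seed t]
        by_cases hinj : Function.Injective p.1
        · exact (measure_mono fun s hs => hs.2).trans (hδ (W p) p.1 hinj)
        · have : (fun s : SketchSeed n b (N + e) => (s, p)) ⁻¹' B = ∅ :=
            Set.eq_empty_of_forall_notMem fun s hs => hinj hs.1
          rw [this, measure_empty]
          exact zero_le
    _ = δ := by simp

end Iterates

theorem theorem2 (μ τ ζ : ℝ) (hμ : 0 < μ) (hτ : 0 < τ) (hζ : 0 < ζ) :
    ∃ κ₁ : ℝ, 0 < κ₁ ∧ ∀ κ₂ : ℝ, κ₁ ≤ κ₂ → ∃ C : ℝ, 0 < C ∧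
      ∀ (d n N e b T : ℕ) (f : Vec d → ℝ) (A : Vec d → Matrix (Fin n) (Fin d) ℝ)
        (k L γ β ε : ℝ) (wstar w₀ : Vec d),
        -- twice differentiable, `k`-strongly convex, `L`-Lipschitz Hessian with square root `A`
        TwiceDifferentiable f →
        0 < k → HessianStronglyConvex k f →
        0 < L → HessianLipschitz L f →
        IsHessianSqrt f A →
        -- the optimal solution and the extreme eigenvalues of the Hessian there
        (∀ w, f wstar ≤ f w) →
        IsLeast {a : ℝ | IsHessianEigenvalue f wstar a} γ →
        IsGreatest {a : ℝ | IsHessianEigenvalue f wstar a} β →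
        0 < ε → ε ≤ γ / (8 * β) →
        -- the straggler tolerance, the number of column blocks and the sketch dimension
        (e : ℝ) ≤ ζ * (N : ℝ) →
        κ₁ / ε ≤ (N : ℝ) + (e : ℝ) → (N : ℝ) + (e : ℝ) ≤ κ₂ / ε →
        C * ((d : ℝ) ^ (1 + μ) / ε ^ 2) ≤ (N : ℝ) * (b : ℝ) + (e : ℝ) * (b : ℝ) →
        ‖w₀ - wstar‖ ≤ γ / (8 * L) →
        1 ≤ T →
        ∀ (Ω : Type*) [MeasurableSpace Ω] (P : Measure Ω) [IsProbabilityMeasure P]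
          (seed : ℕ → Ω → SketchSeed n b (N + e)) (ret : ℕ → Ω → Fin N → Fin (N + e)),
          IsOverSketchProcess P seed ret →
          let S : Ω → ℕ → Matrix (Fin n) (Fin N × Fin b) ℝ :=
            fun ω t => survivingSketch (seed t ω) (ret t ω)
          let w : Ω → ℕ → Vec d := fun ω t => osnIterate f A w₀ (S ω) t
          1 - (T : ℝ) / (d : ℝ) ^ τ ≤
            P.real {ω | ∀ t : ℕ, t ≤ T →
              IsUnit (sketchedHessian (A (w ω t)) (S ω t)).det ∧
              ‖w ω (t + 1) - wstar‖ ≤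
                25 * L / (8 * γ) * ‖w ω t - wstar‖ ^ 2 + 5 * ε * β / γ * ‖w ω t - wstar‖} := by
  obtain ⟨κ₁, hκ₁, hmain⟩ := exists_embedding_constants hμ hτ hζ
  refine ⟨κ₁, hκ₁, fun κ₂ hκ₂ => ?_⟩
  obtain ⟨C, hC, hmain⟩ := hmain κ₂ hκ₂
  refine ⟨C, hC, ?_⟩
  intro d n N e b T f A k L γ β ε wstar w₀ hf hk hconv hL0 hL hA hmin hγ hβ hε0 hε he hK1 hK2 hm
    hw₀ hT Ω _ P _ seed ret hproc S w
  obtain ⟨v, hv⟩ := (hγ.1 : IsHessianEigenvalue f wstar γ).exists_hasEigenvector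
  have hv0 : 0 < ‖v‖ := norm_pos_iff.2 hv.2
  have hγ0 : 0 < γ := by
    have h1 := hconv wstar v
    have h2 : hessian f wstar v = γ • v := hv.apply_eq_smul
    rw [h2, inner_smul_right, real_inner_self_eq_norm_sq] at h1
    exact hk.trans_le (le_of_mul_le_mul_right h1 (by positivity))
  have hd0 : d ≠ 0 := by
    rintro rfl
    exact hv.2 (Subsingleton.elim _ _)
  have hT' : (1 : ℝ) ≤ T := by exact_mod_cast hT
  -- for `d = 1` the claimed probability is at most `0`
  rcases Nat.lt_or_ge d 2 with hd | hd
  · have hd1 : d = 1 := by omega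
    refine le_trans ?_ measureReal_nonneg
    rw [hd1, Nat.cast_one, Real.one_rpow, div_one]
    linarith
  have hD0 : (0 : ℝ) < d := by positivity
  have hβγ : γ ≤ β := hγ.2 hβ.1
  have hβ0 : 0 < β := hγ0.trans_le hβγ
  have hε1 : ε ≤ 1 := by
    refine hε.trans ?_
    rw [div_le_one (by positivity)]
    linarith
  have hb : 0 < b := by
    rcases Nat.eq_zero_or_pos b with h | h
    · exfalso
      rw [h, Nat.cast_zero, mul_zero, mul_zero, add_zero] at hm
      have : 0 < C * ((d : ℝ) ^ (1 + μ) / ε ^ 2) := by positivity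
      linarith
    · exact h
  have hδ : ∀ (x : Vec d) (r : Fin N → Fin (N + e)), Function.Injective r →
      uniformOn (Set.univ : Set (SketchSeed n b (N + e)))
        {s | ¬ IsAccurate ε (A x) (survivingSketch s r)} ≤
        ENNReal.ofReal ((d : ℝ) ^ (-τ) / 2) := by
    intro x r hr
    obtain ⟨B, B', hB, hAB⟩ := exists_whitening (A := A x) (fun y hy => by
      have h1 := hconv x (WithLp.toLp 2 y)
      rw [inner_hessian_eq hA] at h1
      have h2 : (WithLp.toLp 2 y : Vec d) ≠ 0 := fun h => hy (congrArg WithLp.ofLp h)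
      have h3 := norm_pos_iff.2 h2
      exact lt_of_lt_of_le (by positivity) h1)
    have hU : IsContraction (A x * B) := fun y => by
      rw [← dotProduct_transpose_mul_self, hAB, Matrix.one_mulVec]
    have h := hmain d n N e b ε (A x * B) r hd hε0 hε1 he hK1 hK2 hm hU hr
    refine le_trans (measure_mono fun s hs => ?_)
      ((uniformOn_univ_eq_prodExp hb _).trans_le (ENNReal.ofReal_le_ofReal h))
    by_contra hcon
    refine hs (isAccurate_of_whitening hB hAB fun y => ?_)
    rw [Set.mem_ofPred_eq, not_exists] at hcon
    exact not_lt.1 (hcon y)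
  have hbad : ∀ t, P.real {ω | ¬ IsAccurate ε (A (w ω t)) (S ω t)} ≤ (d : ℝ) ^ (-τ) / 2 :=
    fun t => ENNReal.toReal_le_of_le_ofReal (by positivity)
      (measure_not_isAccurate_le P hproc f A w₀ hδ t)
  set G : Set Ω := {ω | ∀ t : ℕ, t ≤ T →
    IsUnit (sketchedHessian (A (w ω t)) (S ω t)).det ∧
    ‖w ω (t + 1) - wstar‖ ≤
      25 * L / (8 * γ) * ‖w ω t - wstar‖ ^ 2 + 5 * ε * β / γ * ‖w ω t - wstar‖} with hG
  have hcover : Set.univ ⊆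
      G ∪ ⋃ t ∈ Finset.range (T + 1), {ω | ¬ IsAccurate ε (A (w ω t)) (S ω t)} := by
    intro ω _
    by_cases hacc : ∀ t ≤ T, IsAccurate ε (A (w ω t)) (S ω t)
    · left
      have hstep := fun t (ht : t ≤ T) (hw : ‖w ω t - wstar‖ ≤ γ / (8 * L)) =>
        newton_step hf hL0 hL hA hmin hγ hβ hγ0 hε0 hε hw (hacc t ht)
          (w' := w ω (t + 1)) rfl
      have hball : ∀ t ≤ T, ‖w ω t - wstar‖ ≤ γ / (8 * L) := by
        intro t
        induction t with
        | zero => exact fun _ => hw₀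
        | succ t ih => exact fun ht => (hstep t (by omega) (ih (by omega))).2.2
      exact fun t ht => ⟨(hstep t ht (hball t ht)).1, (hstep t ht (hball t ht)).2.1⟩
    · right
      push Not at hacc
      obtain ⟨t, ht, hta⟩ := hacc
      exact Set.mem_biUnion (Finset.mem_coe.2 (Finset.mem_range.2 (by omega))) hta
  have h1 : (1 : ℝ) ≤ P.real G + (T + 1) * ((d : ℝ) ^ (-τ) / 2) := by
    calc (1 : ℝ) = P.real Set.univ := by simp
      _ ≤ P.real (G ∪ ⋃ t ∈ Finset.range (T + 1),
          {ω | ¬ IsAccurate ε (A (w ω t)) (S ω t)}) := measureReal_mono hcover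
      _ ≤ P.real G + P.real (⋃ t ∈ Finset.range (T + 1),
          {ω | ¬ IsAccurate ε (A (w ω t)) (S ω t)}) := measureReal_union_le _ _
      _ ≤ P.real G + ∑ _t ∈ Finset.range (T + 1), (d : ℝ) ^ (-τ) / 2 := by
          gcongr
          exact (measureReal_biUnion_finset_le _ _).trans
            (Finset.sum_le_sum fun t _ => hbad t)
      _ = _ := by simp
  have h2 : (T : ℝ) / (d : ℝ) ^ τ = T * (d : ℝ) ^ (-τ) := by
    rw [Real.rpow_neg hD0.le, div_eq_mul_inv]
  have h3 : 0 < (d : ℝ) ^ (-τ) := Real.rpow_pos_of_pos hD0 _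
  rw [h2]
  nlinarith [mul_le_mul_of_nonneg_right hT' h3.le]
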